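/- **Setting.** Let $L$ be a countable signature of continuous logic: each symbol has an arity and a modulus of continuity, each predicate symbol has a compact interval as bound, and there is a distinguished binary predicate symbol $d$ for the metric. An $L$-structure is a nonempty complete metric space $M$ with interpretations of the symbols that respect their moduli and bounds, where $M^n$ carries the maximum metric and $d$ is interpreted as the metric. Formulas of $L_{\omega_1\omega}$ are built from atomic formulas and the constant $\mathbf 1$ by $\phi+\psi$, $r\phi$ ($r\in\mathbb Q$), $\phi\vee\psi=\max(\phi,\psi)$, $\sup_x$, $\inf_x$, and countable suprema $\bigvee_k\phi_k$ and infima $\bigwedge_k\phi_k$ of formulas in the same finitely many free variables that respect a common modulus of continuity and a common bound (in all $L$-structures). A *fragment* $\mathcal F$ is a countable set of such formulas that contains the atomic formulas and is closed under finitary connectives (including $\mathbf 1$), quantifiers, subformulas and substitution of terms for variables. An *$\mathcal F$-theory* $T$ is a set of conditions $\phi=c$ with $\phi$ a sentence of $\mathcal F$ and $c\in\mathbb R$; a model of $T$ is an $L$-structure that satisfies all of them. The type $\operatorname{tp}(\bar a)$ of a finite or infinite tuple $\bar a$ of a model is the map $\phi\mapsto\phi(\bar a)$ on the $\mathcal F$-formulas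 in the corresponding variables; $S_n(T)$ is the set of types of $n$-tuples of models of $T$, and $\tau$ is the topology of pointwise convergence on $\mathcal F$-formulas. For $p,q\in S_n(T)$, $\partial(p,q)\in[0,\infty]$ is the infimum of all $s$ such that for all $\tau$-open $U\ni p$ and $V\ni q$ there are a model $M$ of $T$ and $\bar a,\bar b\in M^n$ with $\operatorname{tp}(\bar a)\in U$, $\operatorname{tp}(\bar b)\in V$ and $d(\bar a,\bar b)<s$. A model of $T$ *omits* $\Xi\subseteq S_n(T)$ if none of its $n$-tuples has its type in $\Xi$. Let $S^{\mathrm{en}}(T)$, with the topology of pointwise convergence on $\mathcal F$-formulas, be the space of those types $\xi$ of sequences $(a_i)_{i\in\mathbb N}$ in models of $T$ such that $(\inf_y\phi(y,\bar x))^{\xi}=\inf_j\phi(x_j,\bar x)^{\xi}$ for every $\phi\in\mathcal F$, where $\bar x=(x_0,x_1,\dots)$. The structure $M_\xi$ coded by $\xi\in S^{\mathrm{en}}(T)$ is the substructure with underlying set $\overline{\{a_i:i\in\mathbb N\}}$, for any sequence $(a_i)$ of type $\xi$ in a model of $T$. **Theorem (Omitting types).** Let $\mathcal F$ be a fragment and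 let $T$ be an $\mathcal F$-theory that has a model. For every $n\in\mathbb N$ let $\Xi_n\subseteq S_n(T)$ be a set that is $\tau$-meager and $\partial$-open in $S_n(T)$. Then there is a separable model of $T$ that omits all of the $\Xi_n$. Moreover, the set of all $\xi\in S^{\mathrm{en}}(T)$ for which the coded structure $M_\xi$ exists and, for every choice of the sequence $(a_i)$, is a separable model of $T$ that omits all of the $\Xi_n$, is comeager in $S^{\mathrm{en}}(T)$. -/

import Mathlib

open Set Filter Topology
open scoped NNReal ENNReal

universe u v

namespace ContLogic

/-- A modulus of continuity. -/
structure Modulus where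
  toFun : ℝ≥0 → ℝ≥0
  continuous_toFun : Continuous toFun
  map_zero : toFun 0 = 0
  le_add : ∀ r s, toFun r ≤ toFun (r + s)
  add_le : ∀ r s, toFun (r + s) ≤ toFun r + toFun s

/-- The map `f` respects the modulus of continuity `Δ`. -/
def Modulus.RespectedBy (Δ : Modulus) {X Y : Type*} [MetricSpace X] [MetricSpace Y]
    (f : X → Y) : Prop :=
  ∀ x y, nndist (f x) (f y) ≤ Δ.toFun (nndist x y)

/-- A countable signature of continuous logic, with its distinguished binary predicate symbol for
the metric. Constants are function symbols of arity `0`. -/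
structure Signature where
  Func : ℕ → Type v
  Pred : ℕ → Type v
  countable_func : ∀ n, Countable (Func n)
  countable_pred : ∀ n, Countable (Pred n)
  funcModulus : ∀ {n}, Func n → Modulus
  predModulus : ∀ {n}, Pred n → Modulus
  predBound : ∀ {n}, Pred n → NonemptyInterval ℝ
  distSymb : Pred 2

/-- Terms in the free variables `x₀, …, xₙ₋₁`. -/
inductive Term (L : Signature.{v}) (n : ℕ) : Type v
  | var (i : Fin n) : Term L n
  | func {k : ℕ} (f : L.Func k) (t : Fin k → Term L n) : Term L n

/-- (Raw) formulas in the free variables `x₀, …, xₙ₋₁`. A quantifier binds the first variable of a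
formula in `n + 1` variables and the others are renumbered. The equicontinuity condition on the
infinitary connectives is imposed by `Formula.IsWellFormed`. -/
inductive Formula (L : Signature.{v}) : ℕ → Type v
  | pred {n k : ℕ} (P : L.Pred k) (t : Fin k → Term L n) : Formula L n
  | one {n : ℕ} : Formula L n
  | add {n : ℕ} (φ ψ : Formula L n) : Formula L n
  | smul {n : ℕ} (r : ℚ) (φ : Formula L n) : Formula L n
  | max {n : ℕ} (φ ψ : Formula L n) : Formula L n
  | sup {n : ℕ} (φ : Formula L (n + 1)) : Formula L n
  | inf {n : ℕ} (φ : Formula L (n + 1)) : Formula L n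
  | iSup {n : ℕ} (φ : ℕ → Formula L n) : Formula L n
  | iInf {n : ℕ} (φ : ℕ → Formula L n) : Formula L n

variable {L : Signature.{v}}

/-- Simultaneous substitution of terms for variables in a term. -/
def Term.subst {n m : ℕ} (σ : Fin n → Term L m) : Term L n → Term L m
  | .var i => σ i
  | .func f t => .func f (fun i => (t i).subst σ)

/-- The substitution `σ` carried under a quantifier: the bound variable is fixed. -/
def liftSubst {n m : ℕ} (σ : Fin n → Term L m) : Fin (n + 1) → Term L (m + 1) :=
  Fin.cons (.var 0) (fun i => (σ i).subst (fun j => .var j.succ))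

/-- Simultaneous capture-avoiding substitution of terms for the free variables of a formula. -/
def Formula.subst {n : ℕ} (φ : Formula L n) : ∀ {m : ℕ}, (Fin n → Term L m) → Formula L m :=
  match φ with
  | .pred P t => fun σ => .pred P (fun i => (t i).subst σ)
  | .one => fun _ => .one
  | .add φ ψ => fun σ => .add (φ.subst σ) (ψ.subst σ)
  | .smul r φ => fun σ => .smul r (φ.subst σ)
  | .max φ ψ => fun σ => .max (φ.subst σ) (ψ.subst σ)
  | .sup φ => fun σ => .sup (φ.subst (liftSubst σ))
  | .inf φ => fun σ => .inf (φ.subst (liftSubst σ))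
  | .iSup φ => fun σ => .iSup (fun k => (φ k).subst σ)
  | .iInf φ => fun σ => .iInf (fun k => (φ k).subst σ)

/-- A metric `L`-structure: a nonempty complete metric space with interpretations of the symbols
that respect their moduli of continuity and bounds. Powers `Fin n → M` carry the maximum metric. -/
structure Struc (L : Signature.{v}) where
  carrier : Type u
  [metric : MetricSpace carrier]
  [complete : CompleteSpace carrier]
  [nonempty : Nonempty carrier]
  func : ∀ {n}, L.Func n → (Fin n → carrier) → carrier
  pred : ∀ {n}, L.Pred n → (Fin n → carrier) → ℝ
  func_respects : ∀ {n} (f : L.Func n), (L.funcModulus f).RespectedBy (func f)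
  pred_respects : ∀ {n} (P : L.Pred n), (L.predModulus P).RespectedBy (pred P)
  pred_mem : ∀ {n} (P : L.Pred n) (a : Fin n → carrier), pred P a ∈ L.predBound P
  pred_dist : ∀ a : Fin 2 → carrier, pred L.distSymb a = dist (a 0) (a 1)

instance : CoeSort (Struc.{u, v} L) (Type u) := ⟨Struc.carrier⟩

attribute [instance] Struc.metric Struc.complete Struc.nonempty

/-- The value of a term at a tuple. -/
def Term.eval (M : Struc.{u, v} L) {n : ℕ} (a : Fin n → M) : Term L n → M
  | .var i => a i
  | .func f t => M.func f (fun i => (t i).eval M a)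

/-- The interpretation of a formula as a real-valued function on tuples. -/
noncomputable def Formula.eval (M : Struc.{u, v} L) {n : ℕ} (φ : Formula L n) :
    (Fin n → M) → ℝ :=
  match φ with
  | .pred P t => fun a => M.pred P (fun i => (t i).eval M a)
  | .one => fun _ => 1
  | .add φ ψ => fun a => φ.eval M a + ψ.eval M a
  | .smul r φ => fun a => (r : ℝ) * φ.eval M a
  | .max φ ψ => fun a => Max.max (φ.eval M a) (ψ.eval M a)
  | .sup φ => fun a => ⨆ y : M, φ.eval M (Fin.cons y a : Fin _ → M)
  | .inf φ => fun a => ⨅ y : M, φ.eval M (Fin.cons y a : Fin _ → M)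
  | .iSup φ => fun a => ⨆ k, (φ k).eval M a
  | .iInf φ => fun a => ⨅ k, (φ k).eval M a

/-- In every `L`-structure, the interpretation of `φ` respects the modulus `Δ` and takes its values
in the compact interval `I`. -/
def Formula.Respects {n : ℕ} (φ : Formula L n) (Δ : Modulus) (I : NonemptyInterval ℝ) : Prop :=
  ∀ M : Struc.{u, v} L, Δ.RespectedBy (φ.eval M) ∧ ∀ a : Fin n → M, φ.eval M a ∈ I

/-- The formulas of `L_{ω₁ω}`: infinitary connectives are applied only to sequences of formulas
that respect a common continuity modulus and a common bound. -/
def Formula.IsWellFormed {n : ℕ} (φ : Formula L n) : Prop :=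
  match φ with
  | .pred _ _ => True
  | .one => True
  | .add φ ψ => φ.IsWellFormed ∧ ψ.IsWellFormed
  | .smul _ φ => φ.IsWellFormed
  | .max φ ψ => φ.IsWellFormed ∧ ψ.IsWellFormed
  | .sup φ => φ.IsWellFormed
  | .inf φ => φ.IsWellFormed
  | .iSup φ => (∀ k, (φ k).IsWellFormed) ∧ ∃ Δ I, ∀ k, Formula.Respects.{u, v} (φ k) Δ I
  | .iInf φ => (∀ k, (φ k).IsWellFormed) ∧ ∃ Δ I, ∀ k, Formula.Respects.{u, v} (φ k) Δ I

/-- A fragment of `L_{ω₁ω}`: a countable collection of formulas containing the atomic formulas and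
closed under finitary connectives, quantifiers, (immediate) subformulas and substitution. -/
structure Fragment (L : Signature.{v}) where
  formulas : ∀ n, Set (Formula L n)
  countable : ∀ n, (formulas n).Countable
  wellFormed : ∀ {n} {φ : Formula L n}, φ ∈ formulas n → Formula.IsWellFormed.{u, v} φ
  pred_mem : ∀ {n k} (P : L.Pred k) (t : Fin k → Term L n), .pred P t ∈ formulas n
  one_mem : ∀ n, .one ∈ formulas n
  add_mem_iff : ∀ {n} {φ ψ : Formula L n},
    .add φ ψ ∈ formulas n ↔ φ ∈ formulas n ∧ ψ ∈ formulas n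
  smul_mem_iff : ∀ {n} {r : ℚ} {φ : Formula L n}, .smul r φ ∈ formulas n ↔ φ ∈ formulas n
  max_mem_iff : ∀ {n} {φ ψ : Formula L n},
    .max φ ψ ∈ formulas n ↔ φ ∈ formulas n ∧ ψ ∈ formulas n
  sup_mem_iff : ∀ {n} {φ : Formula L (n + 1)}, .sup φ ∈ formulas n ↔ φ ∈ formulas (n + 1)
  inf_mem_iff : ∀ {n} {φ : Formula L (n + 1)}, .inf φ ∈ formulas n ↔ φ ∈ formulas (n + 1)
  mem_of_iSup_mem : ∀ {n} {φ : ℕ → Formula L n}, .iSup φ ∈ formulas n → ∀ k, φ k ∈ formulas n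
  mem_of_iInf_mem : ∀ {n} {φ : ℕ → Formula L n}, .iInf φ ∈ formulas n → ∀ k, φ k ∈ formulas n
  subst_mem : ∀ {n m} {φ : Formula L n} (σ : Fin n → Term L m),
    φ ∈ formulas n → φ.subst σ ∈ formulas m

/-- A theory of the fragment `F`: a set of conditions `φ = c`, where `φ` is a sentence of `F` and
`c` is a real number. -/
abbrev Fragment.Theory (F : Fragment.{u, v} L) := Set (F.formulas 0 × ℝ)

variable {F : Fragment.{u, v} L}

/-- `M` is a model of `T`. -/
def Struc.Models (M : Struc.{u, v} L) (T : F.Theory) : Prop :=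
  ∀ c ∈ T, (c.1 : Formula L 0).eval M Fin.elim0 = c.2

/-- The `F`-type of a finite tuple, as a function on the formulas of `F`. -/
noncomputable def Struc.tp (M : Struc.{u, v} L) (F : Fragment.{u, v} L) {n : ℕ} (a : Fin n → M) :
    F.formulas n → ℝ :=
  fun φ => (φ : Formula L n).eval M a

/-- The space `S_n(T)` of realizable `n`-types. As a subspace of a product of copies of `ℝ` it
carries the logic topology `τ`, that is, pointwise convergence on formulas. -/
def TypeSpace (T : F.Theory) (n : ℕ) : Set (F.formulas n → ℝ) :=
  {p | ∃ M : Struc.{u, v} L, M.Models T ∧ ∃ a : Fin n → M, M.tp F a = p}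

/-- The metric `∂` on `S_n(T)`, with values in `[0, ∞]`: the infimum of all `s` such that arbitrarily
`τ`-close to `p` and `q` there are types of tuples of the same model at distance less than `s`. -/
noncomputable def typeDist {T : F.Theory} {n : ℕ} (p q : TypeSpace T n) : ℝ≥0∞ :=
  sInf {s | ∀ U V : Set (TypeSpace T n), IsOpen U → IsOpen V → p ∈ U → q ∈ V →
    ∃ (M : Struc.{u, v} L) (_ : M.Models T) (a b : Fin n → M),
      (∃ p' ∈ U, M.tp F a = p'.1) ∧ (∃ q' ∈ V, M.tp F b = q'.1) ∧ edist a b < s}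

/-- The set `Ξ` of types is open for the metric `∂`. -/
def IsTypeDistOpen {T : F.Theory} {n : ℕ} (Ξ : Set (TypeSpace T n)) : Prop :=
  ∀ p ∈ Ξ, ∃ ε > 0, ∀ q, typeDist p q < ε → q ∈ Ξ

/-- No type in `Ξ` is realized in `M`. -/
def Struc.Omits (M : Struc.{u, v} L) {T : F.Theory} {n : ℕ} (Ξ : Set (TypeSpace T n)) : Prop :=
  ∀ p ∈ Ξ, ∀ a : Fin n → M, M.tp F a ≠ p.1

/-- The formulas of `F` in the infinite tuple of variables `x₀, x₁, …`: each one is a formula in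
`x₀, …, xₙ₋₁` for some `n`. -/
abbrev Fragment.OmegaFormulas (F : Fragment.{u, v} L) := Σ n, F.formulas n

/-- The `F`-type of an infinite sequence. -/
noncomputable def Struc.omegaTp (M : Struc.{u, v} L) (F : Fragment.{u, v} L) (a : ℕ → M) :
    F.OmegaFormulas → ℝ :=
  fun φ => (φ.2 : Formula L φ.1).eval M (fun i => a i)

/-- The space of realizable types in the infinite tuple of variables `x₀, x₁, …`, with the logic
topology. -/
def OmegaTypeSpace (T : F.Theory) : Set (F.OmegaFormulas → ℝ) :=
  {p | ∃ M : Struc.{u, v} L, M.Models T ∧ ∃ a : ℕ → M, M.omegaTp F a = p}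

/-- For a formula `φ(y, x₀, …, xₙ₋₁)`, the formula `inf_y φ(y, x₀, …, xₙ₋₁)`. -/
def Fragment.infFormula {n : ℕ} (φ : F.formulas (n + 1)) : F.OmegaFormulas :=
  ⟨n, .inf φ.1, F.inf_mem_iff.2 φ.2⟩

/-- For a formula `φ(y, x₀, …, xₙ₋₁)`, the formula `φ(x_j, x₀, …, xₙ₋₁)`. -/
def Fragment.instFormula {n : ℕ} (φ : F.formulas (n + 1)) (j : ℕ) : F.OmegaFormulas :=
  ⟨n + (j + 1), φ.1.subst (Fin.cons (.var ⟨j, by omega⟩) (fun i => .var (Fin.castAdd (j + 1) i))),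
    F.subst_mem _ φ.2⟩

/-- The space of types enumerating a model, with the logic topology. -/
def EnumTypeSpace (T : F.Theory) : Set (F.OmegaFormulas → ℝ) :=
  {p | p ∈ OmegaTypeSpace T ∧ ∀ (n : ℕ) (φ : F.formulas (n + 1)),
    p (Fragment.infFormula φ) = ⨅ j, p (Fragment.instFormula φ j)}

/-- The map `ι` is an isomorphism of `M` with a substructure of `N`. -/
structure IsEmbedding (M N : Struc.{u, v} L) (ι : M → N) : Prop where
  isometry : Isometry ι
  map_func : ∀ {n} (f : L.Func n) (a : Fin n → M), ι (M.func f a) = N.func f (ι ∘ a)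
  map_pred : ∀ {n} (P : L.Pred n) (a : Fin n → M), M.pred P a = N.pred P (ι ∘ a)

/-- `M` is (a copy of) the structure coded by `ξ`: the substructure with underlying set the closure
of `{a_i : i ∈ ℕ}`, where `a` is a realization of `ξ` in a model of `T`. -/
def Struc.IsCodedBy (M : Struc.{u, v} L) {T : F.Theory} (ξ : EnumTypeSpace T) : Prop :=
  ∃ (N : Struc.{u, v} L) (a : ℕ → N) (ι : M → N), N.Models T ∧ N.omegaTp F a = ξ.1 ∧
    IsEmbedding M N ι ∧ range ι = closure (range a)

end ContLogic

/-! The proof is a Baire category argument in the space `EnumTypeSpace T`.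

That space is Baire (`baireSpace_enumTypeSpace`). Inside the closure of the realized types, its
points are exactly the `ξ` for which infima and countable connectives have approximate witnesses
(`IsHenkin`). This is a Gδ condition, so the space is a dense Gδ in a closed subset of a countable
power of `ℝ`. The hard inclusion is a Henkin construction: a Henkin point of the closure determines
a pseudometric on the indices, whose completion is made into a structure in which the indices
realize `ξ`.

For injective `i`, the map sending `ξ` to the type of `(a_{i 0}, …, a_{i (n-1)})` is continuous and
open (`EnumTypeSpace.isOpenMap_restrict`), so meager sets pull back to meager sets. Hence for
generic `ξ` no tuple of entries with distinct indices has its type in `Ξ n`. Generically, also,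
every entry is approximated by entries of arbitrarily large index (`eventually_exists_varDist_lt`),
so tuples of entries with distinct indices are dense among the tuples of the coded structure.

By the Tarski–Vaught test (`IsEmbedding.eval_eq`) the coded structure is a model in which tuples
have the same types as in the ambient one. If one of its tuples had type in `Ξ n`, then, `Ξ n` being
`∂`-open, so would a nearby tuple of entries with distinct indices, a contradiction. -/

namespace ContLogic

variable {L : Signature.{v}} {F : Fragment.{u, v} L}

/-! ### Substitution and evaluation. -/

section Substitution

theorem Term.eval_subst (M : Struc.{u, v} L) {n m : ℕ} (σ : Fin n → Term L m) (a : Fin m → M)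
    (t : Term L n) : (t.subst σ).eval M a = t.eval M (fun i => (σ i).eval M a) := by
  induction t with
  | var i => rfl
  | func f t ih => simp only [Term.subst, Term.eval, ih]

theorem eval_liftSubst (M : Struc.{u, v} L) {n m : ℕ} (σ : Fin n → Term L m) (a : Fin m → M)
    (y : M) : (fun i => (liftSubst σ i).eval M (Fin.cons y a : Fin (m + 1) → M)) =
      (Fin.cons y (fun i => (σ i).eval M a) : Fin (n + 1) → M) := by
  funext i
  refine Fin.cases ?_ (fun i => ?_) i
  · simp [liftSubst, Term.eval]
  · simp [liftSubst, Term.eval_subst, Term.eval]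

theorem Formula.eval_subst (M : Struc.{u, v} L) {n : ℕ} (φ : Formula L n) :
    ∀ {m : ℕ} (σ : Fin n → Term L m) (a : Fin m → M),
      (φ.subst σ).eval M a = φ.eval M (fun i => (σ i).eval M a) := by
  induction φ with
  | pred P t => intro m σ a; simp only [Formula.subst, Formula.eval, Term.eval_subst]
  | one => intro m σ a; rfl
  | add φ ψ hφ hψ => intro m σ a; simp only [Formula.subst, Formula.eval, hφ, hψ]
  | smul r φ hφ => intro m σ a; simp only [Formula.subst, Formula.eval, hφ]
  | max φ ψ hφ hψ => intro m σ a; simp only [Formula.subst, Formula.eval, hφ, hψ]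
  | sup φ hφ => intro m σ a; simp only [Formula.subst, Formula.eval, hφ, eval_liftSubst]
  | inf φ hφ => intro m σ a; simp only [Formula.subst, Formula.eval, hφ, eval_liftSubst]
  | iSup φ hφ => intro m σ a; simp only [Formula.subst, Formula.eval, hφ]
  | iInf φ hφ => intro m σ a; simp only [Formula.subst, Formula.eval, hφ]

end Substitution

/-! ### Real suprema and infima of bounded families. -/

section Lattice

variable {ι : Type*} [Nonempty ι] {f g : ι → ℝ} {ε : ℝ}

theorem abs_iSup_sub_iSup_le (hf : BddAbove (range f)) (hg : BddAbove (range g))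
    (h : ∀ i, |f i - g i| ≤ ε) : |(⨆ i, f i) - ⨆ i, g i| ≤ ε := by
  rw [abs_sub_le_iff]
  constructor
  · rw [sub_le_iff_le_add]
    exact ciSup_le fun i => by linarith [le_ciSup hg i, (abs_sub_le_iff.1 (h i)).1]
  · rw [sub_le_iff_le_add]
    exact ciSup_le fun i => by linarith [le_ciSup hf i, (abs_sub_le_iff.1 (h i)).2]

theorem abs_iInf_sub_iInf_le (hf : BddBelow (range f)) (hg : BddBelow (range g))
    (h : ∀ i, |f i - g i| ≤ ε) : |(⨅ i, f i) - ⨅ i, g i| ≤ ε := by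
  rw [abs_sub_le_iff]
  constructor
  · rw [sub_le_comm]
    exact le_ciInf fun i => by linarith [ciInf_le hf i, (abs_sub_le_iff.1 (h i)).1]
  · rw [sub_le_comm]
    exact le_ciInf fun i => by linarith [ciInf_le hg i, (abs_sub_le_iff.1 (h i)).2]

theorem bddAbove_range_of_abs_le {ι : Sort*} {f : ι → ℝ} {C : ℝ} (h : ∀ i, |f i| ≤ C) :
    BddAbove (range f) :=
  ⟨C, by rintro _ ⟨i, rfl⟩; exact (abs_le.1 (h i)).2⟩

theorem bddBelow_range_of_abs_le {ι : Sort*} {f : ι → ℝ} {C : ℝ} (h : ∀ i, |f i| ≤ C) :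
    BddBelow (range f) :=
  ⟨-C, by rintro _ ⟨i, rfl⟩; exact (abs_le.1 (h i)).1⟩

theorem abs_iSup_le {C : ℝ} (h : ∀ i, |f i| ≤ C) : |⨆ i, f i| ≤ C := by
  obtain ⟨i⟩ := ‹Nonempty ι›
  exact abs_le.2 ⟨(abs_le.1 (h i)).1.trans (le_ciSup (bddAbove_range_of_abs_le h) i),
    ciSup_le fun i => (abs_le.1 (h i)).2⟩

theorem abs_iInf_le {C : ℝ} (h : ∀ i, |f i| ≤ C) : |⨅ i, f i| ≤ C := by
  obtain ⟨i⟩ := ‹Nonempty ι›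
  exact abs_le.2 ⟨le_ciInf fun i => (abs_le.1 (h i)).1,
    (ciInf_le (bddBelow_range_of_abs_le h) i).trans (abs_le.1 (h i)).2⟩

end Lattice

/-! ### Uniform continuity and boundedness of formulas. -/

section Continuity

theorem Modulus.exists_lt (Δ : Modulus) {ε : ℝ≥0} (hε : 0 < ε) :
    ∃ δ > 0, ∀ r ≤ δ, Δ.toFun r < ε := by
  have h : ∀ᶠ r in 𝓝 0, Δ.toFun r < ε :=
    Δ.continuous_toFun.continuousAt.eventually_lt continuousAt_const (by rwa [Δ.map_zero])
  obtain ⟨δ, hδ, H⟩ := Metric.eventually_nhds_iff.1 h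
  refine ⟨Real.toNNReal (δ / 2), Real.toNNReal_pos.2 (half_pos hδ), fun r hr => H ?_⟩
  have : (r : ℝ) ≤ δ / 2 := by rwa [← Real.le_toNNReal_iff_coe_le (half_pos hδ).le]
  rw [NNReal.dist_eq]
  simp only [NNReal.coe_zero, sub_zero, NNReal.abs_eq]
  linarith

/-- The same `δ` serves every function respecting `Δ`; this uniformity is what the countable
connectives need. -/
theorem Modulus.exists_dist_lt (Δ : Modulus) {ε : ℝ} (hε : 0 < ε) : ∃ δ > 0,
    ∀ {X Y : Type*} [MetricSpace X] [MetricSpace Y] {f : X → Y}, Δ.RespectedBy f →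
      ∀ x y, dist x y < δ → dist (f x) (f y) < ε := by
  obtain ⟨δ, hδ, H⟩ := Δ.exists_lt (ε := ⟨ε, hε.le⟩) hε
  refine ⟨δ, hδ, fun hf x y hxy => ?_⟩
  have h1 := (hf x y).trans_lt (H (nndist x y) (le_of_lt (by exact_mod_cast hxy)))
  exact_mod_cast h1

theorem Modulus.RespectedBy.uniformContinuous {Δ : Modulus} {X Y : Type*} [MetricSpace X]
    [MetricSpace Y] {f : X → Y} (h : Δ.RespectedBy f) : UniformContinuous f :=
  Metric.uniformContinuous_iff.2 fun _ hε => by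
    obtain ⟨δ, hδ, H⟩ := Δ.exists_dist_lt hε
    exact ⟨δ, hδ, fun {x y} => H h x y⟩

theorem Term.uniformContinuous_eval (M : Struc.{u, v} L) {n : ℕ} (t : Term L n) :
    UniformContinuous fun a : Fin n → M => t.eval M a := by
  induction t with
  | var i => exact Pi.uniformContinuous_proj _ i
  | func f t ih =>
    exact (M.func_respects f).uniformContinuous.comp (uniformContinuous_pi.2 ih)

theorem dist_cons_cons {X : Type*} [PseudoMetricSpace X] {n : ℕ} (y : X) (a b : Fin n → X) :
    dist (Fin.cons y a : Fin (n + 1) → X) (Fin.cons y b) ≤ dist a b := by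
  rw [dist_pi_le_iff dist_nonneg]
  intro i
  refine Fin.cases ?_ (fun i => ?_) i
  · simp
  · simpa using dist_le_pi_dist a b i

/-- Quantifiers inherit the estimates of their body, since prefixing the same point to two tuples
does not increase their distance. For countable connectives the induction hypotheses give no
uniformity in the index; the common modulus and bound from `Formula.IsWellFormed` are used instead.
-/
theorem Formula.uniformContinuous_and_bounded (M : Struc.{u, v} L) {n : ℕ} (φ : Formula L n)
    (h : Formula.IsWellFormed.{u, v} φ) :
    UniformContinuous (φ.eval M) ∧ ∃ C, ∀ a, |φ.eval M a| ≤ C := by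
  induction φ with
  | pred P t =>
    refine ⟨(M.pred_respects P).uniformContinuous.comp
      (uniformContinuous_pi.2 fun i => (t i).uniformContinuous_eval M), ?_⟩
    exact ⟨_, fun a => abs_le_max_abs_abs (M.pred_mem P _).1 (M.pred_mem P _).2⟩
  | one => exact ⟨uniformContinuous_const, 1, fun a => by simp [Formula.eval]⟩
  | add φ ψ hφ hψ =>
    obtain ⟨h1, C1, h2⟩ := hφ h.1
    obtain ⟨h3, C2, h4⟩ := hψ h.2
    exact ⟨h1.add h3, C1 + C2, fun a => (abs_add_le _ _).trans (add_le_add (h2 a) (h4 a))⟩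
  | smul r φ hφ =>
    obtain ⟨h1, C1, h2⟩ := hφ h
    refine ⟨h1.const_mul' (r : ℝ), |(r : ℝ)| * C1, fun a => ?_⟩
    simp only [Formula.eval, abs_mul]
    exact mul_le_mul_of_nonneg_left (h2 a) (abs_nonneg _)
  | max φ ψ hφ hψ =>
    obtain ⟨h1, C1, h2⟩ := hφ h.1
    obtain ⟨h3, C2, h4⟩ := hψ h.2
    refine ⟨?_, Max.max C1 C2, fun a => abs_max_le_max_abs_abs.trans (max_le_max (h2 a) (h4 a))⟩
    refine Metric.uniformContinuous_iff.2 fun ε hε => ?_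
    obtain ⟨δ1, hδ1, H1⟩ := Metric.uniformContinuous_iff.1 h1 ε hε
    obtain ⟨δ2, hδ2, H2⟩ := Metric.uniformContinuous_iff.1 h3 ε hε
    refine ⟨min δ1 δ2, lt_min hδ1 hδ2, fun {a b} hab => ?_⟩
    exact (abs_max_sub_max_le_max _ _ _ _).trans_lt
      (max_lt (H1 (hab.trans_le (min_le_left _ _))) (H2 (hab.trans_le (min_le_right _ _))))
  | sup φ hφ =>
    obtain ⟨h1, C, h2⟩ := hφ h
    refine ⟨Metric.uniformContinuous_iff.2 fun ε hε => ?_, C, fun a => abs_iSup_le fun y => h2 _⟩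
    obtain ⟨δ, hδ, H⟩ := Metric.uniformContinuous_iff.1 h1 (ε / 2) (half_pos hε)
    refine ⟨δ, hδ, fun {a b} hab => (?_ : _ ≤ ε / 2).trans_lt (half_lt_self hε)⟩
    exact abs_iSup_sub_iSup_le (bddAbove_range_of_abs_le fun y => h2 _)
      (bddAbove_range_of_abs_le fun y => h2 _)
      fun y => (H ((dist_cons_cons y a b).trans_lt hab)).le
  | inf φ hφ =>
    obtain ⟨h1, C, h2⟩ := hφ h
    refine ⟨Metric.uniformContinuous_iff.2 fun ε hε => ?_, C, fun a => abs_iInf_le fun y => h2 _⟩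
    obtain ⟨δ, hδ, H⟩ := Metric.uniformContinuous_iff.1 h1 (ε / 2) (half_pos hε)
    refine ⟨δ, hδ, fun {a b} hab => (?_ : _ ≤ ε / 2).trans_lt (half_lt_self hε)⟩
    exact abs_iInf_sub_iInf_le (bddBelow_range_of_abs_le fun y => h2 _)
      (bddBelow_range_of_abs_le fun y => h2 _)
      fun y => (H ((dist_cons_cons y a b).trans_lt hab)).le
  | iSup φ hφ =>
    obtain ⟨-, Δ, I, hΔ⟩ := h
    have hC : ∀ k a, |(φ k).eval M a| ≤ Max.max |I.fst| |I.snd| := fun k a =>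
      abs_le_max_abs_abs ((hΔ k M).2 a).1 ((hΔ k M).2 a).2
    refine ⟨Metric.uniformContinuous_iff.2 fun ε hε => ?_, _, fun a => abs_iSup_le fun k => hC k a⟩
    obtain ⟨δ, hδ, H⟩ := Δ.exists_dist_lt (half_pos hε)
    refine ⟨δ, hδ, fun {a b} hab => (?_ : _ ≤ ε / 2).trans_lt (half_lt_self hε)⟩
    exact abs_iSup_sub_iSup_le (bddAbove_range_of_abs_le fun k => hC k a)
      (bddAbove_range_of_abs_le fun k => hC k b)
      fun k => (H (hΔ k M).1 a b hab).le
  | iInf φ hφ =>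
    obtain ⟨-, Δ, I, hΔ⟩ := h
    have hC : ∀ k a, |(φ k).eval M a| ≤ Max.max |I.fst| |I.snd| := fun k a =>
      abs_le_max_abs_abs ((hΔ k M).2 a).1 ((hΔ k M).2 a).2
    refine ⟨Metric.uniformContinuous_iff.2 fun ε hε => ?_, _, fun a => abs_iInf_le fun k => hC k a⟩
    obtain ⟨δ, hδ, H⟩ := Δ.exists_dist_lt (half_pos hε)
    refine ⟨δ, hδ, fun {a b} hab => (?_ : _ ≤ ε / 2).trans_lt (half_lt_self hε)⟩
    exact abs_iInf_sub_iInf_le (bddBelow_range_of_abs_le fun k => hC k a)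
      (bddBelow_range_of_abs_le fun k => hC k b)
      fun k => (H (hΔ k M).1 a b hab).le

theorem Fragment.uniformContinuous_eval (M : Struc.{u, v} L) {n : ℕ} {φ : Formula L n}
    (h : φ ∈ F.formulas n) : UniformContinuous (φ.eval M) :=
  (φ.uniformContinuous_and_bounded M (F.wellFormed h)).1

theorem Fragment.exists_abs_eval_le (M : Struc.{u, v} L) {n : ℕ} {φ : Formula L n}
    (h : φ ∈ F.formulas n) : ∃ C, ∀ a, |φ.eval M a| ≤ C :=
  (φ.uniformContinuous_and_bounded M (F.wellFormed h)).2

theorem Fragment.bddBelow_eval (M : Struc.{u, v} L) {n : ℕ} {φ : Formula L n}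
    (h : φ ∈ F.formulas n) {ι : Sort*} (a : ι → Fin n → M) :
    BddBelow (range fun i => φ.eval M (a i)) := by
  obtain ⟨C, hC⟩ := Fragment.exists_abs_eval_le M h
  exact bddBelow_range_of_abs_le fun i => hC (a i)

theorem Fragment.bddAbove_eval (M : Struc.{u, v} L) {n : ℕ} {φ : Formula L n}
    (h : φ ∈ F.formulas n) {ι : Sort*} (a : ι → Fin n → M) :
    BddAbove (range fun i => φ.eval M (a i)) := by
  obtain ⟨C, hC⟩ := Fragment.exists_abs_eval_le M h
  exact bddAbove_range_of_abs_le fun i => hC (a i)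

theorem Fragment.bddBelow_eval_iInf (M : Struc.{u, v} L) {n : ℕ} {φ : ℕ → Formula L n}
    (h : .iInf φ ∈ F.formulas n) (a : Fin n → M) :
    BddBelow (range fun k => (φ k).eval M a) := by
  obtain ⟨-, Δ, I, hΔ⟩ := F.wellFormed h
  exact ⟨I.fst, by rintro _ ⟨k, rfl⟩; exact ((hΔ k M).2 a).1⟩

theorem Fragment.bddAbove_eval_iSup (M : Struc.{u, v} L) {n : ℕ} {φ : ℕ → Formula L n}
    (h : .iSup φ ∈ F.formulas n) (a : Fin n → M) :
    BddAbove (range fun k => (φ k).eval M a) := by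
  obtain ⟨-, Δ, I, hΔ⟩ := F.wellFormed h
  exact ⟨I.snd, by rintro _ ⟨k, rfl⟩; exact ((hΔ k M).2 a).2⟩

end Continuity

/-! ### Formulas in arbitrary entries of a sequence. -/

section Renaming

/-- The formula `φ(x_{i 0}, …, x_{i (n - 1)})`. -/
def Fragment.rename {n : ℕ} (φ : F.formulas n) (i : Fin n → ℕ) : F.OmegaFormulas :=
  ⟨Finset.univ.sup i + 1,
    φ.1.subst fun l => .var ⟨i l, Nat.lt_succ_of_le (Finset.le_sup (Finset.mem_univ l))⟩,
    F.subst_mem _ φ.2⟩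

theorem Struc.omegaTp_rename (M : Struc.{u, v} L) (a : ℕ → M) {n : ℕ} (φ : F.formulas n)
    (i : Fin n → ℕ) : M.omegaTp F a (Fragment.rename φ i) = φ.1.eval M (a ∘ i) := by
  simp only [Struc.omegaTp, Fragment.rename, Formula.eval_subst]
  rfl

theorem Struc.omegaTp_instFormula (M : Struc.{u, v} L) (a : ℕ → M) {n : ℕ}
    (φ : F.formulas (n + 1)) (j : ℕ) : M.omegaTp F a (Fragment.instFormula φ j) =
      φ.1.eval M (Fin.cons (a j) (fun l : Fin n => a l) : Fin (n + 1) → M) := by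
  simp only [Struc.omegaTp, Fragment.instFormula, Formula.eval_subst]
  congr 1
  funext l
  refine Fin.cases ?_ (fun l => ?_) l <;> simp [Term.eval]

end Renaming

/-! ### Sequences satisfying the Tarski–Vaught condition. -/

section Vaught

/-- The sequence `a` satisfies the Tarski–Vaught condition in `M`. -/
def Struc.IsVaught (M : Struc.{u, v} L) (F : Fragment.{u, v} L) (a : ℕ → M) : Prop :=
  ∀ (n : ℕ) (φ : F.formulas (n + 1)) (i : Fin n → ℕ),
    ⨅ y : M, φ.1.eval M (Fin.cons y (a ∘ i) : Fin (n + 1) → M) =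
      ⨅ j, φ.1.eval M (Fin.cons (a j) (a ∘ i) : Fin (n + 1) → M)

/-- Parameters with arbitrary indices reduce to an initial segment by substituting variables in `φ`,
with `liftSubst` leaving the quantified variable alone. -/
theorem Struc.isVaught_of_initial {M : Struc.{u, v} L} {a : ℕ → M}
    (h : ∀ (n : ℕ) (φ : F.formulas (n + 1)),
      ⨅ y : M, φ.1.eval M (Fin.cons y (fun l : Fin n => a l) : Fin (n + 1) → M) =
        ⨅ j, φ.1.eval M (Fin.cons (a j) (fun l : Fin n => a l) : Fin (n + 1) → M)) :
    M.IsVaught F a := by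
  intro n φ i
  have := h (Finset.univ.sup i + 1) ⟨φ.1.subst (liftSubst fun l => .var ⟨i l,
    Nat.lt_succ_of_le (Finset.le_sup (Finset.mem_univ l))⟩), F.subst_mem _ φ.2⟩
  simp only [Formula.eval_subst, eval_liftSubst] at this
  exact this

theorem Struc.omegaTp_mem_enumTypeSpace_iff {M : Struc.{u, v} L} {T : F.Theory} (hM : M.Models T)
    {a : ℕ → M} : M.omegaTp F a ∈ EnumTypeSpace T ↔ M.IsVaught F a := by
  constructor
  · intro h
    refine M.isVaught_of_initial fun n φ => ?_
    have := h.2 n φ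
    simp only [Struc.omegaTp_instFormula] at this
    exact this
  · intro h
    refine ⟨⟨M, hM, a, rfl⟩, fun n φ => ?_⟩
    simp only [Struc.omegaTp_instFormula]
    exact h n φ Fin.val

theorem Struc.IsVaught.exists_lt {M : Struc.{u, v} L} {a : ℕ → M} (h : M.IsVaught F a) {n : ℕ}
    {φ : Formula L (n + 1)} (hφ : φ ∈ F.formulas (n + 1)) (i : Fin n → ℕ) {ε : ℝ} (hε : 0 < ε) :
    ∃ j, φ.eval M (Fin.cons (a j) (a ∘ i) : Fin (n + 1) → M) <
      (⨅ y : M, φ.eval M (Fin.cons y (a ∘ i) : Fin (n + 1) → M)) + ε := by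
  rw [h n ⟨φ, hφ⟩ i]
  exact exists_lt_of_ciInf_lt (lt_add_of_pos_right _ hε)

/-- A sequence defined by recursion over its initial segments. -/
def seqRec {X : Type*} (G : ∀ j : ℕ, (Fin j → X) → X) (j : ℕ) : X :=
  G j fun i => seqRec G i
termination_by j
decreasing_by exact i.2

instance Fragment.countable_formulas (F : Fragment.{u, v} L) (n : ℕ) :
    Countable (F.formulas n) :=
  (F.countable n).to_subtype

/-- Infinite repetition allows a task to be postponed until its parameters have been constructed. -/
theorem exists_seq_frequently_eq (X : Type*) [Countable X] [Nonempty X] :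
    ∃ e : ℕ → X, ∀ (x : X) (N : ℕ), ∃ j ≥ N, e j = x := by
  obtain ⟨s, hs⟩ := exists_surjective_nat X
  refine ⟨fun j => s j.unpair.1, fun x N => ?_⟩
  obtain ⟨k, rfl⟩ := hs x
  exact ⟨Nat.pair k N, Nat.right_le_pair k N, by simp⟩

/-- After the prescribed entries `c`, each stage `j` adds an approximate witness for the task `e j`:
a formula whose infimum is to be approached, with an error bound. -/
theorem Struc.exists_isVaught (M : Struc.{u, v} L) (F : Fragment.{u, v} L) {m : ℕ}
    (c : Fin m → M) : ∃ a : ℕ → M, M.IsVaught F a ∧ ∀ l : Fin m, a l = c l := by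
  have : Nonempty (Σ n : ℕ, F.formulas (n + 1) × ℕ) := ⟨0, ⟨.one, F.one_mem _⟩, 0⟩
  obtain ⟨e, he⟩ := exists_seq_frequently_eq (Σ n : ℕ, F.formulas (n + 1) × ℕ)
  have hw : ∀ (t : Σ n : ℕ, F.formulas (n + 1) × ℕ) (b : Fin t.1 → M), ∃ y : M,
      t.2.1.1.eval M (Fin.cons y b : Fin (t.1 + 1) → M) <
        (⨅ y : M, t.2.1.1.eval M (Fin.cons y b : Fin (t.1 + 1) → M)) + 1 / ((t.2.2 : ℝ) + 1) :=
    fun t b => exists_lt_of_ciInf_lt (lt_add_of_pos_right _ Nat.one_div_pos_of_nat)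
  choose w hw using hw
  -- The arbitrary value is taken when the task has parameters that are not yet defined; the task
  -- recurs later.
  let a : ℕ → M := seqRec fun j b => if h : j < m then c ⟨j, h⟩ else
    if h : (e j).1 ≤ j then w (e j) fun l => b (Fin.castLE h l) else Classical.arbitrary M
  have ha : ∀ j, a j = if h : j < m then c ⟨j, h⟩ else
      if h : (e j).1 ≤ j then w (e j) fun l => a l else Classical.arbitrary M := fun j => by
    simp only [a]
    rw [seqRec]
    rfl
  refine ⟨a, M.isVaught_of_initial fun n φ => ?_, fun l => by rw [ha, dif_pos l.2]⟩
  refine le_antisymm (le_ciInf fun j => ciInf_le (Fragment.bddBelow_eval M φ.2 _) (a j)) ?_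
  refine le_of_forall_pos_le_add fun ε hε => ?_
  obtain ⟨k, hk⟩ := exists_nat_one_div_lt hε
  -- Stage `j` must lie past the `m` prescribed entries and past the `n` parameters.
  obtain ⟨j, hj, hej⟩ := he ⟨n, φ, k⟩ (max m n)
  have h1 := ha j
  rw [dif_neg (not_lt.2 ((le_max_left _ _).trans hj)), dif_pos
    (by rw [hej]; exact (le_max_right _ _).trans hj), hej] at h1
  have h2 := hw ⟨n, φ, k⟩ fun l => a l
  rw [← h1] at h2
  exact (ciInf_le (Fragment.bddBelow_eval M φ.2 _) j).trans (h2.le.trans (by gcongr))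

theorem Struc.exists_omegaTp_mem_enumTypeSpace {M : Struc.{u, v} L} {T : F.Theory}
    (hM : M.Models T) {m : ℕ} (c : Fin m → M) :
    ∃ a : ℕ → M, M.omegaTp F a ∈ EnumTypeSpace T ∧ ∀ l : Fin m, a l = c l := by
  obtain ⟨a, ha, hc⟩ := M.exists_isVaught F c
  exact ⟨a, (M.omegaTp_mem_enumTypeSpace_iff hM).2 ha, hc⟩

end Vaught

/-! ### The coded structure and the Tarski–Vaught test. -/

section Coded

/-- The formula `d(t(x₀, …, xₙ₋₁), y)`, where `y` is the first variable. -/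
def Term.distTo {n : ℕ} (t : Term L n) : Formula L (n + 1) :=
  .pred L.distSymb ![t.subst fun l => .var l.succ, .var 0]

theorem Term.distTo_mem (F : Fragment.{u, v} L) {n : ℕ} (t : Term L n) :
    t.distTo ∈ F.formulas (n + 1) :=
  F.pred_mem _ _

theorem Term.eval_distTo (M : Struc.{u, v} L) {n : ℕ} (t : Term L n) (y : M) (b : Fin n → M) :
    t.distTo.eval M (Fin.cons y b : Fin (n + 1) → M) = dist (t.eval M b) y := by
  simp [Term.distTo, Formula.eval, M.pred_dist, Term.eval_subst, Term.eval]

theorem Term.iInf_eval_distTo (M : Struc.{u, v} L) {n : ℕ} (t : Term L n) (b : Fin n → M) :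
    ⨅ y : M, t.distTo.eval M (Fin.cons y b : Fin (n + 1) → M) = 0 := by
  simp only [Term.eval_distTo]
  refine le_antisymm ?_ (le_ciInf fun y => dist_nonneg)
  refine (ciInf_le ⟨0, ?_⟩ (t.eval M b)).trans_eq (dist_self _)
  rintro _ ⟨y, rfl⟩
  exact dist_nonneg

theorem exists_dist_lt_of_mem_closure_range {X : Type*} [PseudoMetricSpace X] {a : ℕ → X} {n : ℕ}
    {b : Fin n → X} (hb : ∀ l, b l ∈ closure (range a)) {δ : ℝ} (hδ : 0 < δ) :
    ∃ i : Fin n → ℕ, dist b (a ∘ i) < δ := by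
  have : ∀ l, ∃ j, dist (b l) (a j) < δ := fun l => Metric.mem_closure_range_iff.1 (hb l) δ hδ
  choose i hi using this
  exact ⟨i, (dist_pi_lt_iff hδ).2 hi⟩

variable {M : Struc.{u, v} L} {a : ℕ → M}

/-- The parameters are moved to entries of the sequence: one third of `ε` pays for the change of
`φ`, one for the change of its infimum, one for the witness. -/
theorem Struc.IsVaught.exists_lt_of_mem_closure (h : M.IsVaught F a) {n : ℕ}
    {φ : Formula L (n + 1)} (hφ : φ ∈ F.formulas (n + 1)) {b : Fin n → M}
    (hb : ∀ l, b l ∈ closure (range a)) {ε : ℝ} (hε : 0 < ε) :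
    ∃ j, φ.eval M (Fin.cons (a j) b : Fin (n + 1) → M) <
      (⨅ y : M, φ.eval M (Fin.cons y b : Fin (n + 1) → M)) + ε := by
  have hε' : 0 < ε / 3 := by positivity
  obtain ⟨δ1, hδ1, H1⟩ := Metric.uniformContinuous_iff.1
    (Fragment.uniformContinuous_eval M hφ) _ hε'
  obtain ⟨δ2, hδ2, H2⟩ := Metric.uniformContinuous_iff.1
    (Fragment.uniformContinuous_eval M (F.inf_mem_iff.2 hφ)) _ hε'
  obtain ⟨i, hi⟩ := exists_dist_lt_of_mem_closure_range hb (lt_min hδ1 hδ2)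
  obtain ⟨j, hj⟩ := h.exists_lt hφ i hε'
  refine ⟨j, ?_⟩
  have h1 := H1 ((dist_cons_cons (a j) b (a ∘ i)).trans_lt (hi.trans_le (min_le_left _ _)))
  have h2 := H2 (hi.trans_le (min_le_right _ _))
  rw [Real.dist_eq, abs_sub_lt_iff] at h1 h2
  simp only [Formula.eval] at h2
  linarith [h1.1, h2.2]

/-- `Struc.IsVaught` speaks of infima only; suprema follow by applying it to `-φ`. -/
theorem Struc.IsVaught.exists_gt_of_mem_closure (h : M.IsVaught F a) {n : ℕ}
    {φ : Formula L (n + 1)} (hφ : φ ∈ F.formulas (n + 1)) {b : Fin n → M}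
    (hb : ∀ l, b l ∈ closure (range a)) {ε : ℝ} (hε : 0 < ε) :
    ∃ j, (⨆ y : M, φ.eval M (Fin.cons y b : Fin (n + 1) → M)) <
      φ.eval M (Fin.cons (a j) b : Fin (n + 1) → M) + ε := by
  have hneg : Formula.smul (-1) φ ∈ F.formulas (n + 1) := F.smul_mem_iff.2 hφ
  obtain ⟨j, hj⟩ := h.exists_lt_of_mem_closure hneg hb (half_pos hε)
  refine ⟨j, lt_of_le_of_lt (ciSup_le fun y => ?_)
    (add_lt_add_right (half_lt_self hε) (φ.eval M (Fin.cons (a j) b : Fin (n + 1) → M)))⟩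
  have := ciInf_le (Fragment.bddBelow_eval M hneg fun y : M => (Fin.cons y b : Fin (n + 1) → M)) y
  simp only [Formula.eval, Rat.cast_neg, Rat.cast_one] at this hj
  linarith

/-- The formula `d(f(x̄), y)` has infimum `0` over `y`, so entries of the sequence come arbitrarily
close to the value of `f`. -/
theorem Struc.IsVaught.func_mem_closure (h : M.IsVaught F a) {n : ℕ} (f : L.Func n)
    {b : Fin n → M} (hb : ∀ l, b l ∈ closure (range a)) : M.func f b ∈ closure (range a) := by
  refine Metric.mem_closure_range_iff.2 fun ε hε => ?_
  obtain ⟨j, hj⟩ := h.exists_lt_of_mem_closure (Term.distTo_mem F (.func f .var)) hb hε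
  rw [Term.iInf_eval_distTo, Term.eval_distTo, zero_add] at hj
  exact ⟨j, hj⟩

/-- The substructure of `M` with a given closed underlying set. -/
def Struc.restrict (M : Struc.{u, v} L) (S : Set M) (hS : IsClosed S) (hne : S.Nonempty)
    (hf : ∀ {n} (f : L.Func n) (b : Fin n → M), (∀ l, b l ∈ S) → M.func f b ∈ S) :
    Struc.{u, v} L where
  carrier := S
  metric := inferInstance
  complete := hS.completeSpace_coe
  nonempty := hne.to_subtype
  func f b := ⟨M.func f fun l => b l, hf f _ fun l => (b l).2⟩
  pred P b := M.pred P fun l => b l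
  func_respects f _ _ := M.func_respects f _ _
  pred_respects P _ _ := M.pred_respects P _ _
  pred_mem P _ := M.pred_mem P _
  pred_dist _ := M.pred_dist _

theorem Struc.exists_isCodedBy {T : F.Theory} (ξ : EnumTypeSpace T) :
    ∃ M : Struc.{u, v} L, M.IsCodedBy ξ := by
  obtain ⟨N, hN, a, ha⟩ := ξ.2.1
  have hV : N.IsVaught F a := (N.omegaTp_mem_enumTypeSpace_iff hN).1 (ha ▸ ξ.2)
  refine ⟨N.restrict (closure (range a)) isClosed_closure (range_nonempty a).closure
    fun f b hb => hV.func_mem_closure f hb, N, a, Subtype.val, hN, ha, ?_, Subtype.range_val⟩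
  exact ⟨isometry_subtype_coe, fun f b => rfl, fun P b => rfl⟩

theorem IsEmbedding.eval_term {M N : Struc.{u, v} L} {ι : M → N} (hι : IsEmbedding M N ι) {n : ℕ}
    (t : Term L n) (b : Fin n → M) : ι (t.eval M b) = t.eval N (ι ∘ b) := by
  induction t with
  | var i => rfl
  | func f t ih => simp only [Term.eval, hι.map_func, Function.comp_def, ih]

theorem comp_cons {X Y : Type*} (ι : X → Y) {n : ℕ} (y : X) (b : Fin n → X) :
    ι ∘ (Fin.cons y b : Fin (n + 1) → X) = Fin.cons (ι y) (ι ∘ b) := by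
  funext l
  refine Fin.cases ?_ (fun l => ?_) l <;> simp

/-- The Tarski–Vaught test for closures of sequences. -/
theorem IsEmbedding.eval_eq {M N : Struc.{u, v} L} {ι : M → N} (hι : IsEmbedding M N ι) {a : ℕ → N}
    (ha : N.IsVaught F a) (hr : range ι = closure (range a)) {n : ℕ} {φ : Formula L n}
    (hφ : φ ∈ F.formulas n) (b : Fin n → M) : φ.eval M b = φ.eval N (ι ∘ b) := by
  have hb : ∀ {n : ℕ} (b : Fin n → M) l, (ι ∘ b) l ∈ closure (range a) := fun b l =>
    hr ▸ mem_range_self (b l)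
  have hy : ∀ j, ∃ y, ι y = a j := fun j => by
    have : a j ∈ range ι := hr ▸ subset_closure (mem_range_self j)
    exact this
  induction φ with
  | pred P t => simp only [Formula.eval, hι.map_pred, Function.comp_def, hι.eval_term]
  | one => rfl
  | add φ ψ h1 h2 =>
    simp only [Formula.eval, h1 (F.add_mem_iff.1 hφ).1, h2 (F.add_mem_iff.1 hφ).2]
  | smul r φ h1 => simp only [Formula.eval, h1 (F.smul_mem_iff.1 hφ)]
  | max φ ψ h1 h2 =>
    simp only [Formula.eval, h1 (F.max_mem_iff.1 hφ).1, h2 (F.max_mem_iff.1 hφ).2]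
  | sup φ h1 =>
    have hφ' := F.sup_mem_iff.1 hφ
    simp only [Formula.eval, h1 hφ', comp_cons]
    refine le_antisymm (ciSup_le fun y => le_ciSup
      (Fragment.bddAbove_eval N hφ' fun y => Fin.cons y (ι ∘ b)) (ι y)) ?_
    refine le_of_forall_pos_le_add fun ε hε => ?_
    obtain ⟨j, hj⟩ := ha.exists_gt_of_mem_closure hφ' (hb b) hε
    obtain ⟨y, hy⟩ := hy j
    rw [← hy] at hj
    refine hj.le.trans (add_le_add_left ?_ ε)
    exact le_ciSup (Fragment.bddAbove_eval N hφ' fun y => Fin.cons (ι y) (ι ∘ b)) y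
  | inf φ h1 =>
    have hφ' := F.inf_mem_iff.1 hφ
    simp only [Formula.eval, h1 hφ', comp_cons]
    refine le_antisymm ?_ (le_ciInf fun y => ciInf_le (Fragment.bddBelow_eval N hφ' _) (ι y))
    refine le_of_forall_pos_le_add fun ε hε => ?_
    obtain ⟨j, hj⟩ := ha.exists_lt_of_mem_closure hφ' (hb b) hε
    obtain ⟨y, hy⟩ := hy j
    rw [← hy] at hj
    refine le_trans ?_ hj.le
    exact ciInf_le (Fragment.bddBelow_eval N hφ' fun y => Fin.cons (ι y) (ι ∘ b)) y
  | iSup φ h1 => simp only [Formula.eval, h1 _ (F.mem_of_iSup_mem hφ _)]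
  | iInf φ h1 => simp only [Formula.eval, h1 _ (F.mem_of_iInf_mem hφ _)]

theorem IsEmbedding.models {M N : Struc.{u, v} L} {ι : M → N} (hι : IsEmbedding M N ι) {a : ℕ → N}
    (ha : N.IsVaught F a) (hr : range ι = closure (range a)) {T : F.Theory} (hN : N.Models T) :
    M.Models T := fun c hc => by
  rw [hι.eval_eq ha hr c.1.2, ← hN c hc]
  congr 1
  exact Subsingleton.elim _ _

theorem IsEmbedding.separableSpace {M N : Struc.{u, v} L} {ι : M → N} (hι : IsEmbedding M N ι)
    {a : ℕ → N} (hr : range ι = closure (range a)) : TopologicalSpace.SeparableSpace M := by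
  have h : TopologicalSpace.IsSeparable (range ι) := by
    rw [hr]
    exact (countable_range a).isSeparable.closure
  have := h.separableSpace
  have e := hι.isometry.isEmbedding.toHomeomorph.symm
  exact e.surjective.denseRange.separableSpace e.continuous

end Coded

/-! ### Completing a pseudometric on the indices and extending functions to it. -/

section Completion

theorem exists_completion_of_dist (d : ℕ → ℕ → ℝ) (h0 : ∀ i, d i i = 0) (hs : ∀ i j, d i j = d j i)
    (ht : ∀ i j k, d i k ≤ d i j + d j k) :
    ∃ (C : Type u) (_ : MetricSpace C) (_ : CompleteSpace C) (e : ℕ → C),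
      DenseRange e ∧ ∀ i j, dist (e i) (e j) = d i j := by
  -- The pseudometric is placed on an abstract carrier because `ℕ` already has a metric instance.
  have key : ∀ (X : Type) (_ : PseudoMetricSpace X) (f : ℕ → X), f.Surjective →
      (∀ i j, dist (f i) (f j) = d i j) →
      ∃ (C : Type u) (_ : MetricSpace C) (_ : CompleteSpace C) (e : ℕ → C),
        DenseRange e ∧ ∀ i j, dist (e i) (e j) = d i j := fun X _ f hf hd => by
    -- `ULift` moves the completion to the universe of structures.
    refine ⟨ULift.{u} (UniformSpace.Completion X), inferInstance, inferInstance,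
      fun i => ⟨(f i : UniformSpace.Completion X)⟩, ?_, fun i j => ?_⟩
    · exact Homeomorph.ulift.symm.surjective.denseRange.comp
        (UniformSpace.Completion.denseRange_coe.comp hf.denseRange
          (UniformSpace.Completion.continuous_coe X)) Homeomorph.ulift.symm.continuous
    · exact (UniformSpace.Completion.dist_eq (f i) (f j)).trans (hd i j)
  exact key ℕ { dist := d, dist_self := h0, dist_comm := hs, dist_triangle := ht } id
    Function.surjective_id fun _ _ => rfl

variable {C : Type*} [MetricSpace C] {e : ℕ → C}

theorem denseRange_comp_left (he : DenseRange e) (k : ℕ) :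
    DenseRange fun i : Fin k → ℕ => e ∘ i := fun b => by
  refine Metric.mem_closure_range_iff.2 fun ε hε => ?_
  exact exists_dist_lt_of_mem_closure_range (fun l => he (b l)) hε

/-- The hypotheses say that `h` behaves like the distance to a point and has infimum `0`. Points `e
(s m)` with `h (s m)` tending to `0` form a Cauchy sequence, and the limit is the required point. -/
theorem exists_dist_eq_of_denseRange [CompleteSpace C] {h : ℕ → ℝ}
    (h1 : ∀ i j, dist (e i) (e j) ≤ h i + h j) (h2 : ∀ i j, h j ≤ h i + dist (e i) (e j))
    (h3 : ∀ ε > 0, ∃ j, h j < ε) : ∃ p : C, ∀ j, dist p (e j) = h j := by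
  have : ∀ m : ℕ, ∃ j, h j < 1 / ((m : ℝ) + 1) := fun m => h3 _ Nat.one_div_pos_of_nat
  choose s hs using this
  have hlim : Tendsto (fun m : ℕ => 1 / ((m : ℝ) + 1)) atTop (𝓝 0) :=
    tendsto_one_div_add_atTop_nhds_zero_nat
  have hc : CauchySeq (e ∘ s) := by
    refine cauchySeq_of_le_tendsto_0 (fun m : ℕ => 1 / ((m : ℝ) + 1) + 1 / ((m : ℝ) + 1))
      (fun n m N hn hm => ?_) (by simpa using hlim.add hlim)
    refine (h1 _ _).trans (add_le_add ((hs n).le.trans ?_) ((hs m).le.trans ?_))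
    · exact Nat.one_div_le_one_div hn
    · exact Nat.one_div_le_one_div hm
  obtain ⟨p, hp⟩ := cauchySeq_tendsto_of_complete hc
  refine ⟨p, fun j => tendsto_nhds_unique (hp.dist tendsto_const_nhds) ?_⟩
  rw [tendsto_iff_dist_tendsto_zero]
  refine squeeze_zero (fun _ => dist_nonneg) (fun m => ?_) hlim
  refine le_trans ?_ (hs m).le
  rw [Real.dist_eq, abs_sub_le_iff, Function.comp_apply]
  constructor
  · linarith [h1 (s m) j]
  · linarith [h2 (s m) j]

/-- The bound extends by density to all `x` in place of `e j`; then take `x = q`. -/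
theorem dist_le_of_denseRange (he : DenseRange e) {p q : C} {B : ℝ}
    (h : ∀ j, |dist p (e j) - dist q (e j)| ≤ B) : dist p q ≤ B := by
  have : ∀ x, |dist p x - dist q x| ≤ B := fun x => by
    refine he.induction_on x (isClosed_le (by fun_prop) continuous_const) h
  simpa using this q

theorem exists_extend_of_denseRange (he : DenseRange e) {Z : Type*} [MetricSpace Z] [CompleteSpace Z]
    {k : ℕ} (Δ : Modulus) {g : (Fin k → ℕ) → Z}
    (hg : ∀ i j, nndist (g i) (g j) ≤ Δ.toFun (nndist (e ∘ i) (e ∘ j))) :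
    ∃ G : (Fin k → C) → Z, Δ.RespectedBy G ∧ ∀ i, G (e ∘ i) = g i := by
  have hd := denseRange_comp_left he k
  -- Different index tuples may name the same point. The choice made here is harmless: `hg` with a
  -- modulus vanishing at `0` forces equal values.
  let g' : range (fun i : Fin k → ℕ => e ∘ i) → Z := fun x => g x.2.choose
  have hg' : Δ.RespectedBy g' := fun x y => by
    have h := hg x.2.choose y.2.choose
    have hx : e ∘ x.2.choose = x.1 := x.2.choose_spec
    have hy : e ∘ y.2.choose = y.1 := y.2.choose_spec
    rw [hx, hy] at h
    exact h
  have hu := hg'.uniformContinuous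
  have hG : ∀ i, Dense.extend hd g' (e ∘ i) = g i := fun i => by
    rw [Dense.extend_of_ind hd hu ⟨e ∘ i, mem_range_self i⟩, ← nndist_eq_zero, ← nonpos_iff_eq_zero]
    have hx : e ∘ (mem_range_self (f := fun i : Fin k → ℕ => e ∘ i) i).choose = e ∘ i :=
      (mem_range_self (f := fun i : Fin k → ℕ => e ∘ i) i).choose_spec
    have h := hg (mem_range_self (f := fun i : Fin k → ℕ => e ∘ i) i).choose i
    rwa [hx, nndist_self, Δ.map_zero] at h
  have hcont : Continuous (Dense.extend hd g') := (Dense.uniformContinuous_extend hd hu).continuous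
  refine ⟨Dense.extend hd g', fun x y => ?_, hG⟩
  refine hd.induction_on₂ (p := fun x y => nndist (Dense.extend hd g' x) (Dense.extend hd g' y) ≤
    Δ.toFun (nndist x y)) ?_ (fun i j => ?_) x y
  · have := Δ.continuous_toFun
    exact isClosed_le (by fun_prop) (by fun_prop)
  · simp only [hG]
    exact hg i j

end Completion

/-! ### Building a structure from the atomic values of `ξ`. -/

section Henkin

-- Closed conditions pass from realized types to their limits. All the identities and inequalities
-- needed for `ξ` are obtained in this way by checking them in models.
@[elab_as_elim]
theorem closure_omegaTypeSpace_induction {T : F.Theory} {P : (F.OmegaFormulas → ℝ) → Prop}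
    (hP : IsClosed {ξ | P ξ})
    (h : ∀ (M : Struc.{u, v} L) (a : ℕ → M), M.Models T → P (M.omegaTp F a))
    {ξ : F.OmegaFormulas → ℝ} (hξ : ξ ∈ closure (OmegaTypeSpace T)) : P ξ :=
  closure_minimal (t := {ξ | P ξ}) (by rintro _ ⟨M, hM, a, rfl⟩; exact h M a hM) hP hξ

/-- The formula `d(t(x₀, …, xₙ₋₁), y)` as an element of the fragment. -/
def Fragment.distTo (F : Fragment.{u, v} L) {n : ℕ} (t : Term L n) : F.formulas (n + 1) :=
  ⟨t.distTo, t.distTo_mem F⟩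

/-- The value assigned by `ξ` to the formula `d(t(x_{i 0}, …, x_{i (n - 1)}), x_j)`. -/
def distVal (ξ : F.OmegaFormulas → ℝ) {n : ℕ} (t : Term L n) (i : Fin n → ℕ) (j : ℕ) : ℝ :=
  ξ (Fragment.rename (F.distTo t) (Fin.cons j i : Fin (n + 1) → ℕ))

/-- The value assigned by `ξ` to the formula `d(x_i, x_j)`. -/
def varDist (ξ : F.OmegaFormulas → ℝ) (i j : ℕ) : ℝ :=
  distVal ξ (.var 0 : Term L 1) (fun _ => i) j

@[fun_prop]
theorem continuous_distVal {n : ℕ} (t : Term L n) (i : Fin n → ℕ) (j : ℕ) :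
    Continuous fun ξ : F.OmegaFormulas → ℝ => distVal ξ t i j :=
  continuous_apply _

@[fun_prop]
theorem continuous_varDist (i j : ℕ) :
    Continuous fun ξ : F.OmegaFormulas → ℝ => varDist ξ i j :=
  continuous_apply _

theorem Struc.distVal_omegaTp (M : Struc.{u, v} L) (a : ℕ → M) {n : ℕ} (t : Term L n)
    (i : Fin n → ℕ) (j : ℕ) : distVal (M.omegaTp F a) t i j = dist (t.eval M (a ∘ i)) (a j) := by
  rw [distVal, Struc.omegaTp_rename, comp_cons]
  exact Term.eval_distTo M t _ _

theorem Struc.varDist_omegaTp (M : Struc.{u, v} L) (a : ℕ → M) (i j : ℕ) :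
    varDist (M.omegaTp F a) i j = dist (a i) (a j) := by
  rw [varDist, Struc.distVal_omegaTp]
  rfl

theorem sup_toNNReal_dist {X : Type*} [PseudoMetricSpace X] {k : ℕ} (x y : Fin k → X) :
    (Finset.univ.sup fun l => Real.toNNReal (dist (x l) (y l))) = nndist x y := by
  rw [nndist_pi_def]
  congr 1
  funext l
  rw [dist_nndist, Real.toNNReal_coe]

theorem continuous_modulus_sup {X : Type*} [TopologicalSpace X] (Δ : Modulus) {k : ℕ}
    {f : Fin k → X → ℝ} (hf : ∀ l, Continuous (f l)) :
    Continuous fun x => (Δ.toFun (Finset.univ.sup fun l => Real.toNNReal (f l x)) : ℝ) := by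
  refine NNReal.continuous_coe.comp (Δ.continuous_toFun.comp ?_)
  exact Continuous.finset_sup_apply fun l _ => continuous_real_toNNReal.comp (hf l)

variable {T : F.Theory} {ξ : F.OmegaFormulas → ℝ}

/-- The modulus of `f` is expressed through values of `ξ` alone, which makes it a closed condition.
-/
theorem abs_distTo_func_sub_le (hξ : ξ ∈ closure (OmegaTypeSpace T)) {n k : ℕ} (f : L.Func k)
    (t : Fin k → Term L n) (i : Fin n → ℕ) (j : Fin k → ℕ) (m : ℕ) :
    |distVal ξ (.func f t) i m -
      distVal ξ (.func f .var) j m| ≤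
    (L.funcModulus f).toFun (Finset.univ.sup fun l => Real.toNNReal
      (distVal ξ (t l) i (j l))) := by
  refine closure_omegaTypeSpace_induction (isClosed_le (by fun_prop)
    (continuous_modulus_sup _ fun l => continuous_apply _)) (fun M a _ => ?_) hξ
  simp only [Struc.distVal_omegaTp]
  refine (abs_dist_sub_le _ _ _).trans ?_
  rw [sup_toNNReal_dist (fun l => (t l).eval M (a ∘ i)) fun l => a (j l)]
  exact M.func_respects f _ _

theorem abs_pred_sub_le (hξ : ξ ∈ closure (OmegaTypeSpace T)) {n k : ℕ} (P : L.Pred k)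
    (t : Fin k → Term L n) (i : Fin n → ℕ) (j : Fin k → ℕ) :
    |ξ (Fragment.rename ⟨.pred P t, F.pred_mem P t⟩ i) -
      ξ (Fragment.rename ⟨.pred P .var, F.pred_mem P .var⟩ j)| ≤
    (L.predModulus P).toFun (Finset.univ.sup fun l => Real.toNNReal
      (distVal ξ (t l) i (j l))) := by
  refine closure_omegaTypeSpace_induction (isClosed_le (by fun_prop)
    (continuous_modulus_sup _ fun l => continuous_apply _)) (fun M a _ => ?_) hξ
  simp only [Struc.distVal_omegaTp, Struc.omegaTp_rename]
  rw [sup_toNNReal_dist (fun l => (t l).eval M (a ∘ i)) fun l => a (j l)]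
  exact M.pred_respects P _ _

/-- The carrier is the completion of the indices under `varDist ξ`. By `hw`, each instance of a term
is a limit of indices and so names a point `nm`. Symbols are defined on tuples of indices by these
names and by the values of `ξ`, then extended by their moduli. -/
theorem exists_struc_of_atomic (hξ : ξ ∈ closure (OmegaTypeSpace T))
    (hw : ∀ (n : ℕ) (t : Term L n) (i : Fin n → ℕ), ∀ ε > 0, ∃ j,
      distVal ξ t i j < ε) :
    ∃ (M : Struc.{u, v} L) (a : ℕ → M), DenseRange a ∧
      ∀ (n k : ℕ) (P : L.Pred k) (t : Fin k → Term L n) (i : Fin n → ℕ),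
        M.pred P (fun l => (t l).eval M (a ∘ i)) =
          ξ (Fragment.rename ⟨.pred P t, F.pred_mem P t⟩ i) := by
  have hvar : ∀ {n : ℕ} (l : Fin n) (i : Fin n → ℕ) (j : ℕ), distVal ξ (.var l) i j = varDist ξ (i l) j :=
    fun l i j => closure_omegaTypeSpace_induction (isClosed_eq (by fun_prop) (by fun_prop))
      (fun M a _ => by simp [Struc.distVal_omegaTp, Struc.varDist_omegaTp, Term.eval]) hξ
  have hd0 : ∀ i, varDist ξ i i = 0 := fun i =>
    closure_omegaTypeSpace_induction (isClosed_eq (by fun_prop) (by fun_prop))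
      (fun M a _ => by simp [Struc.varDist_omegaTp]) hξ
  have hds : ∀ i j, varDist ξ i j = varDist ξ j i := fun i j =>
    closure_omegaTypeSpace_induction (isClosed_eq (by fun_prop) (by fun_prop))
      (fun M a _ => by simp [Struc.varDist_omegaTp, dist_comm]) hξ
  have ht1 : ∀ {n : ℕ} (t : Term L n) (i : Fin n → ℕ) (j m : ℕ), distVal ξ t i m ≤ distVal ξ t i j + varDist ξ j m :=
    fun t i j m => closure_omegaTypeSpace_induction (isClosed_le (by fun_prop) (by fun_prop))
      (fun M a _ => by
        simpa [Struc.distVal_omegaTp, Struc.varDist_omegaTp, Term.eval] using dist_triangle _ _ _) hξ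
  have ht2 : ∀ {n : ℕ} (t : Term L n) (i : Fin n → ℕ) (j m : ℕ), varDist ξ j m ≤ distVal ξ t i j + distVal ξ t i m :=
    fun t i j m => closure_omegaTypeSpace_induction (isClosed_le (by fun_prop) (by fun_prop))
      (fun M a _ => by
        simpa [Struc.distVal_omegaTp, Struc.varDist_omegaTp, Term.eval] using dist_triangle_left _ _ _) hξ
  obtain ⟨C, _, _, e, he, hed⟩ := exists_completion_of_dist.{u} (varDist ξ) hd0 hds
    fun i j k => ht1 (.var 0 : Term L 1) (fun _ => i) j k
  have hnm : ∀ (n : ℕ) (t : Term L n) (i : Fin n → ℕ), ∃ p : C, ∀ j, dist p (e j) = distVal ξ t i j :=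
    fun n t i => exists_dist_eq_of_denseRange (fun j m => (hed j m).trans_le (ht2 t i j m))
      (fun j m => (hed j m).symm ▸ ht1 t i j m) (hw n t i)
  choose nm hnm using hnm
  have hnmvar : ∀ {n : ℕ} (l : Fin n) (i : Fin n → ℕ), nm n (.var l) i = e (i l) := fun l i => by
    refine dist_le_zero.1 (dist_le_of_denseRange he fun j => ?_)
    rw [hnm, hed, hvar, sub_self, abs_zero]
  have hsup : ∀ {n k : ℕ} (t : Fin k → Term L n) (i : Fin n → ℕ) (j : Fin k → ℕ),
      (Finset.univ.sup fun l => Real.toNNReal (distVal ξ (t l) i (j l))) =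
        nndist (fun l => nm n (t l) i) (e ∘ j) := fun t i j => by
    rw [← sup_toNNReal_dist]
    simp only [Function.comp_apply, hnm]
  have hfunc : ∀ {n k : ℕ} (f : L.Func k) (t : Fin k → Term L n) (i : Fin n → ℕ) (j : Fin k → ℕ),
      nndist (nm n (.func f t) i) (nm k (.func f .var) j) ≤
        (L.funcModulus f).toFun (nndist (fun l => nm n (t l) i) (e ∘ j)) := fun f t i j => by
    rw [← hsup, ← NNReal.coe_le_coe, coe_nndist]
    refine dist_le_of_denseRange he fun m => ?_
    rw [hnm, hnm]
    exact abs_distTo_func_sub_le hξ f t i j m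
  have hpred : ∀ {n k : ℕ} (P : L.Pred k) (t : Fin k → Term L n) (i : Fin n → ℕ) (j : Fin k → ℕ),
      nndist (ξ (Fragment.rename ⟨.pred P t, F.pred_mem P t⟩ i))
        (ξ (Fragment.rename ⟨.pred P .var, F.pred_mem P .var⟩ j)) ≤
        (L.predModulus P).toFun (nndist (fun l => nm n (t l) i) (e ∘ j)) := fun P t i j => by
    rw [← hsup, ← NNReal.coe_le_coe, coe_nndist, Real.dist_eq]
    exact abs_pred_sub_le hξ P t i j
  have hcomp : ∀ {k : ℕ} (i : Fin k → ℕ), (fun l => nm k (.var l) i) = e ∘ i := fun i =>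
    funext fun l => hnmvar l i
  have hF : ∀ {k : ℕ} (f : L.Func k), ∃ G : (Fin k → C) → C, (L.funcModulus f).RespectedBy G ∧
      ∀ i, G (e ∘ i) = nm k (.func f .var) i := fun f =>
    exists_extend_of_denseRange he _ fun i j => hcomp i ▸ hfunc f .var i j
  have hP : ∀ {k : ℕ} (P : L.Pred k), ∃ G : (Fin k → C) → ℝ, (L.predModulus P).RespectedBy G ∧
      ∀ i, G (e ∘ i) = ξ (Fragment.rename ⟨.pred P .var, F.pred_mem P .var⟩ i) := fun P =>
    exists_extend_of_denseRange he _ fun i j => hcomp i ▸ hpred P .var i j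
  choose fn hfn hfne using @hF
  choose pr hpr hpre using @hP
  let M : Struc.{u, v} L :=
    { carrier := C
      nonempty := ⟨e 0⟩
      func := fn
      pred := pr
      func_respects := hfn
      pred_respects := hpr
      pred_mem := fun P b => by
        refine (denseRange_comp_left he _).induction_on (p := fun b => pr P b ∈ L.predBound P) b
          ?_ fun i => ?_
        · exact isClosed_Icc.preimage (hpr P).uniformContinuous.continuous
        · rw [hpre]
          exact closure_omegaTypeSpace_induction (isClosed_Icc.preimage (continuous_apply _))
            (fun M a _ => by rw [Struc.omegaTp_rename]; exact M.pred_mem P _) hξ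
      pred_dist := fun b => by
        refine (denseRange_comp_left he _).induction_on
          (p := fun b => pr L.distSymb b = dist (b 0) (b 1)) b ?_ fun i => ?_
        · exact isClosed_eq (hpr _).uniformContinuous.continuous (by fun_prop)
        · rw [hpre, Function.comp_apply, Function.comp_apply, hed]
          exact closure_omegaTypeSpace_induction (isClosed_eq (by fun_prop) (by fun_prop))
            (fun M a _ => by
              simp [Struc.varDist_omegaTp, Struc.omegaTp_rename, Term.eval, Formula.eval,
                M.pred_dist]) hξ }
  have hterm : ∀ {n : ℕ} (t : Term L n) (i : Fin n → ℕ),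
      t.eval M (fun l => e (i l)) = nm n t i := fun {n} t i => by
    induction t with
    | var l => exact (hnmvar l i).symm
    | @func k f t ih =>
      -- By density the modulus bound holds for every `b`; taking `b` to be the named values of the
      -- arguments makes its right side `0`.
      have key : ∀ b : Fin k → C, nndist (nm n (.func f t) i) (fn f b) ≤
          (L.funcModulus f).toFun (nndist (fun l => nm n (t l) i) b) := fun b => by
        refine (denseRange_comp_left he _).induction_on b ?_ fun j => ?_
        · have h1 := (hfn f).uniformContinuous.continuous
          have h2 := (L.funcModulus f).continuous_toFun
          exact isClosed_le (by fun_prop) (by fun_prop)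
        · rw [hfne]
          exact hfunc f t i j
      have h := key fun l => nm n (t l) i
      rw [nndist_self, Modulus.map_zero, nonpos_iff_eq_zero, nndist_eq_zero] at h
      rw [h]
      exact congrArg (fn f) (funext ih)
  refine ⟨M, e, he, fun n k P t i => ?_⟩
  have key : ∀ b : Fin k → C, nndist (ξ (Fragment.rename ⟨.pred P t, F.pred_mem P t⟩ i))
      (pr P b) ≤ (L.predModulus P).toFun (nndist (fun l => nm n (t l) i) b) := fun b => by
    refine (denseRange_comp_left he _).induction_on b ?_ fun j => ?_
    · have h1 := (hpr P).uniformContinuous.continuous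
      have h2 := (L.predModulus P).continuous_toFun
      exact isClosed_le (by fun_prop) (by fun_prop)
    · rw [hpre]
      exact hpred P t i j
  have h := key fun l => nm n (t l) i
  rw [nndist_self, Modulus.map_zero, nonpos_iff_eq_zero, nndist_eq_zero] at h
  rw [h]
  exact congrArg (pr P) (funext fun l => hterm (t l) i)

end Henkin

/-! ### The enumerating types form a Baire space. -/

section Baire

/-- The infima and suprema in formulas, as evaluated by `ξ`, have approximate witnesses. -/
def IsHenkin (ξ : F.OmegaFormulas → ℝ) : Prop :=
  (∀ (n : ℕ) (φ : F.formulas (n + 1)) (i : Fin n → ℕ) (k : ℕ),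
    ∃ j, ξ (Fragment.rename φ (Fin.cons j i : Fin (n + 1) → ℕ)) <
      ξ (Fragment.rename ⟨.inf φ.1, F.inf_mem_iff.2 φ.2⟩ i) + 1 / ((k : ℝ) + 1)) ∧
  (∀ (n : ℕ) (φ : {φ : ℕ → Formula L n // .iInf φ ∈ F.formulas n}) (i : Fin n → ℕ) (k : ℕ),
    ∃ l, ξ (Fragment.rename ⟨φ.1 l, F.mem_of_iInf_mem φ.2 l⟩ i) <
      ξ (Fragment.rename ⟨_, φ.2⟩ i) + 1 / ((k : ℝ) + 1)) ∧
  (∀ (n : ℕ) (φ : {φ : ℕ → Formula L n // .iSup φ ∈ F.formulas n}) (i : Fin n → ℕ) (k : ℕ),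
    ∃ l, ξ (Fragment.rename ⟨_, φ.2⟩ i) <
      ξ (Fragment.rename ⟨φ.1 l, F.mem_of_iSup_mem φ.2 l⟩ i) + 1 / ((k : ℝ) + 1))

/-- For fixed parameters, existence of a witness is a union of open conditions. There are countably
many parameters because `F` is countable and a sequence of formulas is determined by its infinitary
connective. -/
theorem isGδ_setOf_isHenkin (F : Fragment.{u, v} L) :
    IsGδ {ξ : F.OmegaFormulas → ℝ | IsHenkin ξ} := by
  have h1 : ∀ n, Countable {φ : ℕ → Formula L n // .iInf φ ∈ F.formulas n} := fun n =>
    Function.Injective.countable (f := fun φ => (⟨_, φ.2⟩ : F.formulas n)) fun φ ψ h => by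
      simpa [Subtype.ext_iff] using h
  have h2 : ∀ n, Countable {φ : ℕ → Formula L n // .iSup φ ∈ F.formulas n} := fun n =>
    Function.Injective.countable (f := fun φ => (⟨_, φ.2⟩ : F.formulas n)) fun φ ψ h => by
      simpa [Subtype.ext_iff] using h
  simp only [IsHenkin, ofPred_and, ofPred_forall, ofPred_exists]
  refine IsGδ.inter ?_ (IsGδ.inter ?_ ?_)
  all_goals
    exact .iInter fun n => .iInter fun φ => .iInter fun i => .iInter fun k =>
      (isOpen_iUnion fun j => isOpen_lt (by fun_prop) (by fun_prop)).isGδ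

theorem continuous_cons {X : Type*} [TopologicalSpace X] {n : ℕ} (b : Fin n → X) :
    Continuous fun y : X => (Fin.cons y b : Fin (n + 1) → X) :=
  continuous_pi fun l => Fin.cases (by simpa using continuous_id')
    (fun l => by simpa using continuous_const) l

variable {T : F.Theory} {ξ : F.OmegaFormulas → ℝ}

theorem IsHenkin.exists_distVal_lt (h : IsHenkin ξ) (hξ : ξ ∈ closure (OmegaTypeSpace T)) {n : ℕ}
    (t : Term L n) (i : Fin n → ℕ) {ε : ℝ} (hε : 0 < ε) : ∃ j, distVal ξ t i j < ε := by
  obtain ⟨k, hk⟩ := exists_nat_one_div_lt hε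
  obtain ⟨j, hj⟩ := h.1 n (F.distTo t) i k
  have h0 : ξ (Fragment.rename ⟨.inf (F.distTo t).1, F.inf_mem_iff.2 (F.distTo t).2⟩ i) = 0 :=
    closure_omegaTypeSpace_induction (isClosed_eq (by fun_prop) (by fun_prop))
      (fun M a _ => by
        rw [Struc.omegaTp_rename]
        exact t.iInf_eval_distTo M _) hξ
  rw [h0, zero_add] at hj
  exact ⟨j, hj.trans hk⟩

theorem rename_inf_le (hξ : ξ ∈ closure (OmegaTypeSpace T)) {n : ℕ} (φ : F.formulas (n + 1))
    (i : Fin n → ℕ) (j : ℕ) : ξ (Fragment.rename ⟨.inf φ.1, F.inf_mem_iff.2 φ.2⟩ i) ≤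
      ξ (Fragment.rename φ (Fin.cons j i : Fin (n + 1) → ℕ)) :=
  closure_omegaTypeSpace_induction (isClosed_le (by fun_prop) (by fun_prop))
    (fun M a _ => by
      rw [Struc.omegaTp_rename, Struc.omegaTp_rename, comp_cons]
      exact ciInf_le (Fragment.bddBelow_eval M φ.2 fun y => Fin.cons y (a ∘ i)) (a j)) hξ

theorem le_rename_sup (hξ : ξ ∈ closure (OmegaTypeSpace T)) {n : ℕ} (φ : F.formulas (n + 1))
    (i : Fin n → ℕ) (j : ℕ) : ξ (Fragment.rename φ (Fin.cons j i : Fin (n + 1) → ℕ)) ≤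
      ξ (Fragment.rename ⟨.sup φ.1, F.sup_mem_iff.2 φ.2⟩ i) :=
  closure_omegaTypeSpace_induction (isClosed_le (by fun_prop) (by fun_prop))
    (fun M a _ => by
      rw [Struc.omegaTp_rename, Struc.omegaTp_rename, comp_cons]
      exact le_ciSup (Fragment.bddAbove_eval M φ.2 fun y => Fin.cons y (a ∘ i)) (a j)) hξ

/-- `IsHenkin` has no clause for the quantifier `sup`; the witness comes from the infimum of `-φ`.
-/
theorem IsHenkin.exists_sup_lt (h : IsHenkin ξ) (hξ : ξ ∈ closure (OmegaTypeSpace T)) {n : ℕ}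
    (φ : F.formulas (n + 1)) (i : Fin n → ℕ) (k : ℕ) :
    ∃ j, ξ (Fragment.rename ⟨.sup φ.1, F.sup_mem_iff.2 φ.2⟩ i) <
      ξ (Fragment.rename φ (Fin.cons j i : Fin (n + 1) → ℕ)) + 1 / ((k : ℝ) + 1) := by
  have hneg : Formula.smul (-1) φ.1 ∈ F.formulas (n + 1) := F.smul_mem_iff.2 φ.2
  obtain ⟨j, hj⟩ := h.1 n ⟨_, hneg⟩ i k
  have h1 : ξ (Fragment.rename ⟨_, hneg⟩ (Fin.cons j i : Fin (n + 1) → ℕ)) =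
      -ξ (Fragment.rename φ (Fin.cons j i : Fin (n + 1) → ℕ)) :=
    closure_omegaTypeSpace_induction (isClosed_eq (by fun_prop) (by fun_prop))
      (fun M a _ => by
        simp only [Struc.omegaTp_rename, Formula.eval]
        simp) hξ
  have h2 : ξ (Fragment.rename ⟨.sup φ.1, F.sup_mem_iff.2 φ.2⟩ i) ≤
      -ξ (Fragment.rename ⟨_, F.inf_mem_iff.2 hneg⟩ i) :=
    closure_omegaTypeSpace_induction (isClosed_le (by fun_prop) (by fun_prop))
      (fun M a _ => by
        simp only [Struc.omegaTp_rename, Formula.eval]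
        refine ciSup_le fun y => ?_
        have := ciInf_le (Fragment.bddBelow_eval M hneg fun y : M => Fin.cons y (a ∘ i)) y
        simp only [Formula.eval, Rat.cast_neg, Rat.cast_one] at this ⊢
        linarith) hξ
  exact ⟨j, by linarith⟩

/-- Induction on formulas shows that the structure built from the atomic values gives every formula
its value under `ξ`. For quantifiers and countable connectives, one inequality is a closed condition
and the other is supplied by a Henkin witness. -/
theorem IsHenkin.mem_enumTypeSpace (h : IsHenkin ξ) (hξ : ξ ∈ closure (OmegaTypeSpace T)) :
    ξ ∈ EnumTypeSpace T := by
  obtain ⟨M, a, ha, hatom⟩ := exists_struc_of_atomic hξ fun n t i ε hε =>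
    h.exists_distVal_lt hξ t i hε
  have key : ∀ {n : ℕ} (φ : Formula L n) (hφ : φ ∈ F.formulas n) (i : Fin n → ℕ),
      φ.eval M (a ∘ i) = ξ (Fragment.rename ⟨φ, hφ⟩ i) := fun φ hφ i => by
    induction φ with
    | pred P t => exact hatom _ _ P t i
    | one =>
      exact (closure_omegaTypeSpace_induction (isClosed_eq (by fun_prop) (by fun_prop))
        (fun M a _ => by rw [Struc.omegaTp_rename]; rfl) hξ : ξ _ = 1).symm
    | add φ ψ h1 h2 =>
      have hφ' := F.add_mem_iff.1 hφ
      simp only [Formula.eval, h1 hφ'.1, h2 hφ'.2]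
      exact closure_omegaTypeSpace_induction (isClosed_eq (by fun_prop) (by fun_prop))
        (fun M a _ => by simp only [Struc.omegaTp_rename, Formula.eval]) hξ
    | smul r φ h1 =>
      have hφ' := F.smul_mem_iff.1 hφ
      simp only [Formula.eval, h1 hφ']
      exact closure_omegaTypeSpace_induction (isClosed_eq (by fun_prop) (by fun_prop))
        (fun M a _ => by simp only [Struc.omegaTp_rename, Formula.eval]) hξ
    | max φ ψ h1 h2 =>
      have hφ' := F.max_mem_iff.1 hφ
      simp only [Formula.eval, h1 hφ'.1, h2 hφ'.2]
      exact closure_omegaTypeSpace_induction (isClosed_eq (by fun_prop) (by fun_prop))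
        (fun M a _ => by simp only [Struc.omegaTp_rename, Formula.eval]) hξ
    | sup φ h1 =>
      have hφ' := F.sup_mem_iff.1 hφ
      have hc := (Fragment.uniformContinuous_eval M hφ').continuous
      refine le_antisymm (ciSup_le fun y => ?_) (le_of_forall_pos_le_add fun ε hε => ?_)
      -- Uniform continuity reduces an arbitrary `y` to an entry of the dense sequence.
      · refine ha.induction_on y (isClosed_le (hc.comp (continuous_cons _)) continuous_const)
          fun j => ?_
        rw [← comp_cons, h1 hφ']
        exact le_rename_sup hξ ⟨φ, hφ'⟩ i j
      · obtain ⟨k, hk⟩ := exists_nat_one_div_lt hε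
        obtain ⟨j, hj⟩ := h.exists_sup_lt hξ ⟨φ, hφ'⟩ i k
        rw [← h1 hφ', comp_cons] at hj
        refine hj.le.trans (add_le_add ?_ hk.le)
        exact le_ciSup (Fragment.bddAbove_eval M hφ' fun y => Fin.cons y (a ∘ i)) (a j)
    | inf φ h1 =>
      have hφ' := F.inf_mem_iff.1 hφ
      have hc := (Fragment.uniformContinuous_eval M hφ').continuous
      refine le_antisymm (le_of_forall_pos_le_add fun ε hε => ?_) (le_ciInf fun y => ?_)
      · obtain ⟨k, hk⟩ := exists_nat_one_div_lt hε
        obtain ⟨j, hj⟩ := h.1 _ ⟨φ, hφ'⟩ i k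
        rw [← h1 hφ', comp_cons] at hj
        refine le_trans ?_ (hj.le.trans (add_le_add le_rfl hk.le))
        exact ciInf_le (Fragment.bddBelow_eval M hφ' fun y => Fin.cons y (a ∘ i)) (a j)
      · refine ha.induction_on y (isClosed_le continuous_const (hc.comp (continuous_cons _)))
          fun j => ?_
        rw [← comp_cons, h1 hφ']
        exact rename_inf_le hξ ⟨φ, hφ'⟩ i j
    | iSup φ h1 =>
      have hφ' := F.mem_of_iSup_mem hφ
      refine le_antisymm (ciSup_le fun l => ?_) (le_of_forall_pos_le_add fun ε hε => ?_)
      · rw [h1 l (hφ' l)]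
        exact closure_omegaTypeSpace_induction (isClosed_le (by fun_prop) (by fun_prop))
          (fun M a _ => by
            simp only [Struc.omegaTp_rename]
            exact le_ciSup (Fragment.bddAbove_eval_iSup M hφ (a ∘ i)) l) hξ
      · obtain ⟨k, hk⟩ := exists_nat_one_div_lt hε
        obtain ⟨l, hl⟩ := h.2.2 _ ⟨φ, hφ⟩ i k
        rw [← h1 l] at hl
        refine hl.le.trans (add_le_add ?_ hk.le)
        exact le_ciSup (Fragment.bddAbove_eval_iSup M hφ (a ∘ i)) l
    | iInf φ h1 =>
      have hφ' := F.mem_of_iInf_mem hφ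
      refine le_antisymm (le_of_forall_pos_le_add fun ε hε => ?_) (le_ciInf fun l => ?_)
      · obtain ⟨k, hk⟩ := exists_nat_one_div_lt hε
        obtain ⟨l, hl⟩ := h.2.1 _ ⟨φ, hφ⟩ i k
        rw [← h1 l] at hl
        refine le_trans ?_ (hl.le.trans (add_le_add le_rfl hk.le))
        exact ciInf_le (Fragment.bddBelow_eval_iInf M hφ (a ∘ i)) l
      · rw [h1 l (hφ' l)]
        exact closure_omegaTypeSpace_induction (isClosed_le (by fun_prop) (by fun_prop))
          (fun M a _ => by
            simp only [Struc.omegaTp_rename]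
            exact ciInf_le (Fragment.bddBelow_eval_iInf M hφ (a ∘ i)) l) hξ
  have hM : M.Models T := fun c hc => by
    rw [Subsingleton.elim (Fin.elim0 : Fin 0 → M) (a ∘ Fin.elim0), key c.1.1 c.1.2]
    exact closure_omegaTypeSpace_induction (isClosed_eq (by fun_prop) (by fun_prop))
      (fun M a hM => by
        rw [Struc.omegaTp_rename, Subsingleton.elim (a ∘ Fin.elim0) (Fin.elim0 : Fin 0 → M)]
        exact hM c hc) hξ
  have htp : M.omegaTp F a = ξ := by
    funext ⟨n, φ⟩
    refine (key φ.1 φ.2 Fin.val).trans ?_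
    exact closure_omegaTypeSpace_induction (isClosed_eq (by fun_prop) (by fun_prop))
      (fun M a _ => by rw [Struc.omegaTp_rename]; rfl) hξ
  rw [← htp, M.omegaTp_mem_enumTypeSpace_iff hM]
  refine fun n φ i => le_antisymm
    (le_ciInf fun j => ciInf_le (Fragment.bddBelow_eval M φ.2 fun y => Fin.cons y (a ∘ i)) (a j))
    (le_of_forall_pos_le_add fun ε hε => ?_)
  obtain ⟨k, hk⟩ := exists_nat_one_div_lt hε
  obtain ⟨j, hj⟩ := h.1 n φ i k
  rw [← key φ.1 φ.2, ← key _ (F.inf_mem_iff.2 φ.2), comp_cons] at hj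
  refine le_trans ?_ (hj.le.trans (add_le_add le_rfl hk.le))
  exact ciInf_le (Fragment.bddBelow_eval M φ.2 fun j => Fin.cons (a j) (a ∘ i)) j

theorem isHenkin_of_mem_enumTypeSpace (h : ξ ∈ EnumTypeSpace T) : IsHenkin ξ := by
  obtain ⟨M, hM, a, rfl⟩ := h.1
  have hV := (M.omegaTp_mem_enumTypeSpace_iff hM).1 h
  refine ⟨fun n φ i k => ?_, fun n φ i k => ?_, fun n φ i k => ?_⟩ <;>
    simp only [Struc.omegaTp_rename, comp_cons, Formula.eval]
  · exact hV.exists_lt φ.2 i Nat.one_div_pos_of_nat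
  · exact exists_lt_of_ciInf_lt (lt_add_of_pos_right _ Nat.one_div_pos_of_nat)
  · simp only [← sub_lt_iff_lt_add]
    exact exists_lt_of_lt_ciSup (sub_lt_self _ Nat.one_div_pos_of_nat)

instance baireSpace_enumTypeSpace (T : F.Theory) : BaireSpace (EnumTypeSpace T) := by
  let K := closure (EnumTypeSpace T)
  let S : Set K := Subtype.val ⁻¹' EnumTypeSpace T
  have hKT : K ⊆ closure (OmegaTypeSpace T) := closure_mono fun ξ hξ => hξ.1
  have hS : S = Subtype.val ⁻¹' {ξ : F.OmegaFormulas → ℝ | IsHenkin ξ} := by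
    ext ξ
    exact ⟨isHenkin_of_mem_enumTypeSpace, fun h => h.mem_enumTypeSpace (hKT ξ.2)⟩
  have hG : IsGδ S := by
    rw [hS]
    exact (isGδ_setOf_isHenkin F).preimage continuous_subtype_val
  have hd : Dense S := by
    rw [Subtype.dense_iff]
    intro ξ hξ
    rwa [Subtype.image_preimage_coe, inter_eq_right.2 subset_closure]
  -- `F` is countable, so the ambient product of copies of `ℝ` is Polish.
  have : PolishSpace K := isClosed_closure.polishSpace
  have : BaireSpace S := hG.baireSpace_of_dense hd
  let e : S ≃ₜ EnumTypeSpace T :=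
    { toFun := fun x => ⟨x.1.1, x.2⟩
      invFun := fun x => ⟨⟨x.1, subset_closure x.2⟩, x.2⟩
      left_inv := fun _ => rfl
      right_inv := fun _ => rfl
      continuous_toFun := by fun_prop
      continuous_invFun := by fun_prop }
  exact e.baireSpace

end Baire

/-! ### Generic properties of enumerating types. -/

section Generic

/-- Every logic neighbourhood of the type of a sequence contains one defined by a single formula. -/
theorem Struc.exists_formula_of_mem_isOpen {M : Struc.{u, v} L} {a : ℕ → M}
    {U : Set (F.OmegaFormulas → ℝ)} (hU : IsOpen U) (ha : M.omegaTp F a ∈ U) (N : ℕ) :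
    ∃ m ≥ N, ∃ ψ ∈ F.formulas m, ψ.eval M (fun l : Fin m => a l) < 0 ∧
      ∀ (M' : Struc.{u, v} L) (a' : ℕ → M'), ψ.eval M' (fun l : Fin m => a' l) < 0 →
        M'.omegaTp F a' ∈ U := by
  classical
  obtain ⟨I, V, hV, hVU⟩ := isOpen_pi_iff.1 hU _ ha
  suffices h : ∃ m ≥ N, ∃ ψ ∈ F.formulas m, ψ.eval M (fun l : Fin m => a l) < 0 ∧
      ∀ (M' : Struc.{u, v} L) (a' : ℕ → M'), ψ.eval M' (fun l : Fin m => a' l) < 0 →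
        ∀ φ ∈ I, M'.omegaTp F a' φ ∈ V φ by
    obtain ⟨m, hm, ψ, hψ, h1, h2⟩ := h
    exact ⟨m, hm, ψ, hψ, h1, fun M' a' h => hVU fun φ hφ => h2 M' a' h φ hφ⟩
  clear hVU
  induction I using Finset.induction_on with
  | empty =>
    -- No constraint is left, so the always negative formula `-1` serves.
    exact ⟨N, le_rfl, .smul (-1) .one, F.smul_mem_iff.2 (F.one_mem N), by simp [Formula.eval],
      by simp⟩
  | insert φ I _ ih =>
    obtain ⟨m, hm, ψ, hψ, h1, h2⟩ := ih fun φ hφ => hV φ (Finset.mem_insert_of_mem hφ)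
    obtain ⟨hVo, hφV⟩ := hV φ (Finset.mem_insert_self _ _)
    obtain ⟨l, r, hlr, hsub⟩ := mem_nhds_iff_exists_Ioo_subset.1 (hVo.mem_nhds hφV)
    -- The endpoints must be rational to occur as coefficients; `max` then acts as conjunction of
    -- the conditions `< 0`.
    obtain ⟨p, hp, hp'⟩ := exists_rat_btwn hlr.1
    obtain ⟨q, hq', hq⟩ := exists_rat_btwn hlr.2
    obtain ⟨k, φ⟩ := φ
    have hev : ∀ (M' : Struc.{u, v} L) (a' : ℕ → M'),
        (Formula.max (ψ.subst fun l => .var (Fin.castLE (le_max_left m k) l))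
          (.max (.add (.smul p .one) (.smul (-1)
              (φ.1.subst fun l => .var (Fin.castLE (le_max_right m k) l))))
            (.add (φ.1.subst fun l => .var (Fin.castLE (le_max_right m k) l))
              (.smul (-q) .one)))).eval M' (fun l : Fin (max m k) => a' l) < 0 ↔
        ψ.eval M' (fun l : Fin m => a' l) < 0 ∧ M'.omegaTp F a' ⟨k, φ⟩ ∈ Ioo (p : ℝ) q := by
      intro M' a'
      simp only [Formula.eval, Formula.eval_subst, Term.eval, max_lt_iff, Fin.val_castLE,
        Struc.omegaTp, mem_Ioo, Rat.cast_neg, Rat.cast_one, mul_one, neg_mul, one_mul,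
        ← sub_eq_add_neg, sub_neg]
    refine ⟨max m k, hm.trans (le_max_left _ _), _, ?_, (hev M a).2 ⟨h1, hp', hq'⟩,
      fun M' a' h χ hχ => ?_⟩
    · have hφ := F.subst_mem (fun l => .var (Fin.castLE (le_max_right m k) l)) φ.2
      have hone := F.one_mem (max m k)
      exact F.max_mem_iff.2 ⟨F.subst_mem _ hψ, F.max_mem_iff.2
        ⟨F.add_mem_iff.2 ⟨F.smul_mem_iff.2 hone, F.smul_mem_iff.2 hφ⟩,
          F.add_mem_iff.2 ⟨hφ, F.smul_mem_iff.2 hone⟩⟩⟩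
    · obtain ⟨h3, h4⟩ := (hev M' a').1 h
      rcases Finset.mem_insert.1 hχ with rfl | hχ
      · exact hsub ⟨hp.trans h4.1, h4.2.trans hq⟩
      · exact h2 M' a' h3 χ hχ

/-- The formula obtained by taking the infimum over the first `m` variables. -/
def Formula.infs {n : ℕ} : ∀ m : ℕ, Formula L (n + m) → Formula L n
  | 0, φ => φ
  | m + 1, φ => Formula.infs m (.inf φ)

theorem Formula.infs_mem {n : ℕ} : ∀ (m : ℕ) {φ : Formula L (n + m)},
    φ ∈ F.formulas (n + m) → φ.infs m ∈ F.formulas n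
  | 0, _, h => h
  | m + 1, _, h => Formula.infs_mem m (F.inf_mem_iff.2 h)

/-- Because the inequality is strict, each infimum is exactly an existential quantifier. The
quantified variables are the first `m`; `c` fills the last `n`. -/
theorem Formula.eval_infs_lt_iff (M : Struc.{u, v} L) {n : ℕ} (c : Fin n → M) (r : ℝ) (m : ℕ)
    {φ : Formula L (n + m)} (hφ : φ ∈ F.formulas (n + m)) :
    (φ.infs m).eval M c < r ↔
      ∃ b : Fin (n + m) → M, (∀ j : Fin n, b ⟨m + j, by omega⟩ = c j) ∧ φ.eval M b < r := by
  induction m with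
  | zero =>
    constructor
    · intro h
      exact ⟨c, fun j => congrArg c (Fin.ext (Nat.zero_add _)), h⟩
    · rintro ⟨b, hb, h⟩
      have : b = c := funext fun j => by
        rw [← hb j]
        exact congrArg b (Fin.ext (Nat.zero_add _).symm)
      rwa [this] at h
  | succ m ih =>
    have hφ' : Formula.inf φ ∈ F.formulas (n + m) := F.inf_mem_iff.2 hφ
    rw [Formula.infs, ih hφ']
    constructor
    · rintro ⟨b, hb, h⟩
      obtain ⟨y, hy⟩ := exists_lt_of_ciInf_lt h
      refine ⟨(Fin.cons y b : Fin (n + m + 1) → M), fun j => ?_, hy⟩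
      rw [← hb j]
      have : (⟨m + 1 + j, by omega⟩ : Fin (n + m + 1)) = Fin.succ ⟨m + j, by omega⟩ :=
        Fin.ext (by simp only [Fin.val_succ]; omega)
      exact (congrArg (Fin.cons y b : Fin (n + m + 1) → M) this).trans (Fin.cons_succ _ _ _)
    · rintro ⟨b, hb, h⟩
      refine ⟨Fin.tail (n := n + m) b, fun j => ?_, ?_⟩
      · rw [← hb j]
        exact congrArg b (Fin.ext (by simp only [Fin.val_succ]; omega))
      · refine (ciInf_le (Fragment.bddBelow_eval M (n := n + m + 1) hφ fun y : M =>
          (Fin.cons y (Fin.tail (n := n + m) b) : Fin (n + m + 1) → M))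
          (b (0 : Fin (n + m + 1)))).trans_lt ?_
        rwa [Fin.cons_self_tail]

variable {T : F.Theory}

/-- The type of the subtuple `(a_{i 0}, …, a_{i (n - 1)})` of a sequence `a` of type `ξ`. -/
def EnumTypeSpace.restrict {n : ℕ} (i : Fin n → ℕ) (ξ : EnumTypeSpace T) : TypeSpace T n :=
  ⟨fun φ => ξ.1 (Fragment.rename φ i), by
    obtain ⟨M, hM, a, ha⟩ := ξ.2.1
    refine ⟨M, hM, a ∘ i, ?_⟩
    funext φ
    rw [← ha, Struc.omegaTp_rename]
    rfl⟩

theorem EnumTypeSpace.restrict_eq {n : ℕ} (i : Fin n → ℕ) {ξ : EnumTypeSpace T}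
    {M : Struc.{u, v} L} {a : ℕ → M} (h : M.omegaTp F a = ξ.1) :
    M.tp F (a ∘ i) = (EnumTypeSpace.restrict i ξ).1 := by
  funext φ
  simp only [EnumTypeSpace.restrict, ← h, Struc.omegaTp_rename]
  rfl

theorem EnumTypeSpace.continuous_restrict {n : ℕ} (i : Fin n → ℕ) :
    Continuous (EnumTypeSpace.restrict (T := T) i) := by
  refine Continuous.subtype_mk (continuous_pi fun φ => ?_) _
  exact (continuous_apply (Fragment.rename φ i)).comp continuous_subtype_val

/-- Near `ξ` only a condition `ψ < 0` on the first `m` entries matters. Quantifying away the entries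
not indexed by `i` leaves an open condition on the `n`-type. Conversely, a tuple satisfying it,
together with its witnesses, extends to an enumerating sequence by
`Struc.exists_omegaTp_mem_enumTypeSpace`. -/
theorem EnumTypeSpace.isOpenMap_restrict {n : ℕ} {i : Fin n → ℕ} (hi : i.Injective) :
    IsOpenMap (EnumTypeSpace.restrict (T := T) i) := by
  rintro _ ⟨U, hU, rfl⟩
  rw [isOpen_iff_mem_nhds]
  rintro _ ⟨ξ, hξ, rfl⟩
  obtain ⟨M, hM, a, ha⟩ := ξ.2.1
  obtain ⟨m, hm, ψ, hψ, h1, h2⟩ := Struc.exists_formula_of_mem_isOpen hU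
    (show M.omegaTp F a ∈ U from ha ▸ hξ) (Finset.univ.sup i + 1)
  have him : ∀ j, i j < m := fun j =>
    (Nat.lt_succ_of_le (Finset.le_sup (f := i) (Finset.mem_univ j))).trans_le hm
  -- The variable `x_{i j}` becomes the free variable `m + j`, unambiguously since `i` is injective;
  -- every other `x_l` becomes the quantified variable `l`. Quantified variables with index in the
  -- range of `i` are dummies.
  let σ : Fin m → Fin (n + m) := fun l =>
    if h : ∃ j, i j = l then ⟨m + h.choose, by omega⟩ else ⟨l, by omega⟩
  have hσ : ∀ j, σ ⟨i j, him j⟩ = ⟨m + j, by omega⟩ := fun j => by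
    have h : ∃ j', i j' = i j := ⟨j, rfl⟩
    simp only [σ, dif_pos h, hi h.choose_spec]
  have hσψ : ψ.subst (fun l => .var (σ l)) ∈ F.formulas (n + m) := F.subst_mem _ hψ
  have hχ := Formula.infs_mem m hσψ
  refine mem_of_superset (IsOpen.mem_nhds (s := {p : TypeSpace T n | p.1 ⟨_, hχ⟩ < 0})
    (isOpen_lt ((continuous_apply _).comp continuous_subtype_val) continuous_const) ?_) ?_
  · rw [mem_ofPred_eq, ← EnumTypeSpace.restrict_eq i ha]
    refine (Formula.eval_infs_lt_iff M _ 0 m hσψ).2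
      ⟨fun l => if h : l.1 < m then a l else a (i ⟨l - m, by omega⟩), fun j => by simp, ?_⟩
    rw [Formula.eval_subst]
    convert h1 using 2
    funext l
    by_cases h : ∃ j, i j = l
    · obtain ⟨j, hj⟩ := h
      obtain rfl : l = ⟨i j, him j⟩ := Fin.ext hj.symm
      simp [hσ, Term.eval]
    · simp [σ, h, Term.eval]
  · rintro p hp
    obtain ⟨M', hM', c, hc⟩ := p.2
    rw [mem_ofPred_eq, ← hc] at hp
    obtain ⟨b, hb, hb'⟩ := (Formula.eval_infs_lt_iff M' c 0 m hσψ).1 hp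
    rw [Formula.eval_subst] at hb'
    obtain ⟨a', ha', hab⟩ := Struc.exists_omegaTp_mem_enumTypeSpace hM' fun l => b (σ l)
    refine ⟨⟨_, ha'⟩, h2 M' a' ?_, Subtype.ext ?_⟩
    · simp only [hab]
      exact hb'
    · rw [← EnumTypeSpace.restrict_eq i rfl, ← hc]
      congr 1
      funext j
      rw [← hb j, ← hσ j, ← hab ⟨i j, him j⟩]
      rfl

theorem eventually_restrict_notMem {n : ℕ} {Ξ : Set (TypeSpace T n)} (hΞ : IsMeagre Ξ)
    {i : Fin n → ℕ} (hi : i.Injective) :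
    ∀ᶠ ξ in residual (EnumTypeSpace T), EnumTypeSpace.restrict i ξ ∉ Ξ :=
  hΞ.preimage_of_isOpenMap (EnumTypeSpace.continuous_restrict i)
    (EnumTypeSpace.isOpenMap_restrict hi)

/-- Density holds because a basic open set constrains only the first `m` entries, so entry `m` may
be chosen to repeat entry `i`. This provides approximations with distinct indices, as the openness
of restriction requires. -/
theorem eventually_exists_varDist_lt (T : F.Theory) (i N : ℕ) {ε : ℝ} (hε : 0 < ε) :
    ∀ᶠ ξ in residual (EnumTypeSpace T), ∃ j ≥ N, varDist ξ.1 i j < ε := by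
  refine residual_of_dense_open ?_ ?_
  · simp only [ofPred_exists, ofPred_and]
    exact isOpen_iUnion fun j => isOpen_const.inter
      (isOpen_lt ((continuous_varDist i j).comp continuous_subtype_val) continuous_const)
  · rw [dense_iff_inter_open]
    rintro _ ⟨U, hU, rfl⟩ ⟨ξ, hξ⟩
    obtain ⟨M, hM, a, ha⟩ := ξ.2.1
    obtain ⟨m, hm, ψ, hψ, h1, h2⟩ := Struc.exists_formula_of_mem_isOpen hU
      (show M.omegaTp F a ∈ U from ha ▸ hξ) (max N (i + 1))
    obtain ⟨a', ha', hab⟩ := Struc.exists_omegaTp_mem_enumTypeSpace hM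
      (Fin.snoc (fun l : Fin m => a l) (a i) : Fin (m + 1) → M)
    have hlt : ∀ l : Fin m, a' l = a l := fun l => by
      simpa using hab l.castSucc
    have him : i < m := (le_max_right _ _).trans hm
    have hm' : a' m = a i := by simpa using hab (Fin.last m)
    refine ⟨⟨_, ha'⟩, h2 M a' ?_, m, (le_max_left _ _).trans hm, ?_⟩
    · simpa only [hlt] using h1
    · rw [Struc.varDist_omegaTp, hm', hlt ⟨i, him⟩, dist_self]
      exact hε

/-- The one pair `a`, `b` serves for all neighbourhoods `U` and `V`. -/
theorem typeDist_le_edist {M : Struc.{u, v} L} (hM : M.Models T) {n : ℕ} {a b : Fin n → M}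
    {p q : TypeSpace T n} (hp : M.tp F a = p.1) (hq : M.tp F b = q.1) :
    typeDist p q ≤ edist a b := by
  refine le_of_forall_gt_imp_ge_of_dense fun s hs => sInf_le fun U V _ _ hpU hqV => ?_
  exact ⟨M, hM, a, b, ⟨p, hpU, hp⟩, ⟨q, hqV, hq⟩, hs⟩

theorem exists_injective_edist_lt {X : Type*} [PseudoMetricSpace X] {a : ℕ → X}
    (ha : ∀ (i N : ℕ), ∀ ε > 0, ∃ j ≥ N, dist (a i) (a j) < ε) {n : ℕ} {b : Fin n → X}
    (hb : ∀ l, b l ∈ closure (range a)) {ε : ℝ≥0∞} (hε : 0 < ε) :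
    ∃ i : Fin n → ℕ, i.Injective ∧ edist b (a ∘ i) < ε := by
  obtain ⟨δ, hδ, hδε⟩ := ENNReal.lt_iff_exists_nnreal_btwn.1 hε
  have hδ' : (0 : ℝ) < δ := by exact_mod_cast hδ
  -- A strictly increasing choice of indices gives injectivity; the requirement is vacuous for `l ≥
  -- n`.
  obtain ⟨φ, hφ, h⟩ := extraction_forall_of_frequently
    (P := fun l j => ∀ h : l < n, dist (b ⟨l, h⟩) (a j) < δ) fun l => by
      rw [frequently_atTop]
      intro N
      by_cases hl : l < n
      · obtain ⟨i, hi⟩ := Metric.mem_closure_range_iff.1 (hb ⟨l, hl⟩) _ (half_pos hδ')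
        obtain ⟨j, hj, hij⟩ := ha i N _ (half_pos hδ')
        exact ⟨j, hj, fun _ => by linarith [dist_triangle (b ⟨l, hl⟩) (a i) (a j)]⟩
      · exact ⟨N, le_rfl, fun h => absurd h hl⟩
  refine ⟨fun l => φ l, hφ.injective.comp Fin.val_injective, lt_of_le_of_lt ?_ hδε⟩
  rw [edist_nndist, ENNReal.coe_le_coe, ← NNReal.coe_le_coe, coe_nndist, dist_pi_le_iff hδ'.le]
  exact fun l => (h l l.2).le

theorem Struc.IsCodedBy.separableSpace_models_omits {M : Struc.{u, v} L} {ξ : EnumTypeSpace T}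
    (h : M.IsCodedBy ξ) {Ξ : ∀ n : ℕ, Set (TypeSpace T n)} (hopen : ∀ n, IsTypeDistOpen (Ξ n))
    (hΞ : ∀ (n : ℕ) (i : Fin n → ℕ), i.Injective → EnumTypeSpace.restrict i ξ ∉ Ξ n)
    (hd : ∀ i N k : ℕ, ∃ j ≥ N, varDist ξ.1 i j < 1 / ((k : ℝ) + 1)) :
    TopologicalSpace.SeparableSpace M ∧ M.Models T ∧ ∀ n, M.Omits (Ξ n) := by
  obtain ⟨N, a, ι, hN, ha, hι, hr⟩ := h
  have hV : N.IsVaught F a := (N.omegaTp_mem_enumTypeSpace_iff hN).1 (ha ▸ ξ.2)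
  refine ⟨hι.separableSpace hr, hι.models hV hr hN, fun n p hp b hb => ?_⟩
  have hp' : N.tp F (ι ∘ b) = p.1 := by
    rw [← hb]
    funext φ
    exact (hι.eval_eq hV hr φ.2 b).symm
  obtain ⟨ε, hε, hball⟩ := hopen n p hp
  obtain ⟨i, hi, hib⟩ := exists_injective_edist_lt (a := a) (fun i m ε hε => by
      obtain ⟨k, hk⟩ := exists_nat_one_div_lt hε
      obtain ⟨j, hj, hij⟩ := hd i m k
      rw [← ha, Struc.varDist_omegaTp] at hij
      exact ⟨j, hj, hij.trans hk⟩)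
    (b := ι ∘ b) (fun l => hr ▸ mem_range_self (b l)) hε
  -- The approximating entries lie in the same model as `ι ∘ b`, so their type is within
  -- `∂`-distance `ε` of `p` and falls in `Ξ n`.
  exact hΞ n i hi (hball _
    ((typeDist_le_edist hN hp' (EnumTypeSpace.restrict_eq i ha)).trans_lt hib))

end Generic

end ContLogic

/-! ### The omitting types theorem. -/

theorem mainTheorem6 (L : ContLogic.Signature.{v}) (F : ContLogic.Fragment.{u, v} L)
    (T : F.Theory) (hT : ∃ M : ContLogic.Struc.{u, v} L, M.Models T)
    (Ξ : ∀ n : ℕ, Set (ContLogic.TypeSpace T n))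
    (hmeager : ∀ n, IsMeagre (Ξ n)) (hopen : ∀ n, ContLogic.IsTypeDistOpen (Ξ n)) :
    (∃ M : ContLogic.Struc.{u, v} L,
      TopologicalSpace.SeparableSpace M ∧ M.Models T ∧ ∀ n, M.Omits (Ξ n)) ∧
    (∀ᶠ ξ : ContLogic.EnumTypeSpace T in residual (ContLogic.EnumTypeSpace T),
      (∃ M : ContLogic.Struc.{u, v} L, M.IsCodedBy ξ) ∧
      ∀ M : ContLogic.Struc.{u, v} L, M.IsCodedBy ξ →
        TopologicalSpace.SeparableSpace M ∧ M.Models T ∧ ∀ n, M.Omits (Ξ n)) := by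
  have hgen : ∀ᶠ ξ : ContLogic.EnumTypeSpace T in residual (ContLogic.EnumTypeSpace T),
      (∃ M : ContLogic.Struc.{u, v} L, M.IsCodedBy ξ) ∧
      ∀ M : ContLogic.Struc.{u, v} L, M.IsCodedBy ξ →
        TopologicalSpace.SeparableSpace M ∧ M.Models T ∧ ∀ n, M.Omits (Ξ n) := by
    have h1 : ∀ᶠ ξ in residual (ContLogic.EnumTypeSpace T), ∀ (n : ℕ) (i : Fin n → ℕ),
        i.Injective → ContLogic.EnumTypeSpace.restrict i ξ ∉ Ξ n := by
      simp only [eventually_countable_forall]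
      exact fun n i hi => ContLogic.eventually_restrict_notMem (hmeager n) hi
    have h2 : ∀ᶠ ξ in residual (ContLogic.EnumTypeSpace T), ∀ i N k : ℕ,
        ∃ j ≥ N, ContLogic.varDist ξ.1 i j < 1 / ((k : ℝ) + 1) := by
      simp only [eventually_countable_forall]
      exact fun i N k => ContLogic.eventually_exists_varDist_lt T i N Nat.one_div_pos_of_nat
    filter_upwards [h1, h2] with ξ hξ1 hξ2
    exact ⟨ContLogic.Struc.exists_isCodedBy ξ,
      fun M hM => hM.separableSpace_models_omits hopen hξ1 hξ2⟩
  refine ⟨?_, hgen⟩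
  obtain ⟨M, hM⟩ := hT
  -- A comeager set in a Baire space is dense, but it has a point only if the space does; an
  -- enumerating sequence in the given model supplies one.
  obtain ⟨a, ha, -⟩ := ContLogic.Struc.exists_omegaTp_mem_enumTypeSpace hM (Fin.elim0 : Fin 0 → M)
  have : Nonempty (ContLogic.EnumTypeSpace T) := ⟨⟨_, ha⟩⟩
  obtain ⟨ξ, ⟨M', hM'⟩, h⟩ := (dense_of_mem_residual hgen).nonempty
  exact ⟨M', h M' hM'⟩
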